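/- Let $l\in(0,\infty)$, let $\mathcal J\in\mathbb C^{p\times p}$ satisfy $\mathcal J^*=\mathcal J^{-1}=-\mathcal J$, and let $\mathcal F,\mathcal H$ be Hermitian $p\times p$ matrix functions with entries in $L^1(0,l)$, $\mathcal H(t)\ge 0$ a.e., such that every absolutely continuous $f$ with $\mathcal Jf'+\mathcal Ff=0$ and $\mathcal Hf=0$ a.e. vanishes on $(0,l)$. Let $L^2_{\mathcal H}=L^2_{\mathcal H}(0,l)$ be the Hilbert space of classes of measurable $f$ with $\int_0^l f^*\mathcal Hf\,dt<\infty$, with inner product $(f,g)=\int_0^l g^*\mathcal Hf\,dt$. Let $A_{\max}$ be the linear relation of all pairs of classes $(f,g)$ having representatives, $f$ absolutely continuous on $[0,l]$, with $\mathcal Jf'+\mathcal Ff=\mathcal Hg$ a.e., and let $A$ be the closure of the restriction of $A_{\max}$ to those pairs for which $f$ has compact support in $(0,l)$. Let $\mathfrak H_+=\operatorname{dom}A^*$ with norm given by $\|f\|_+^2=\|f\|^2+\|P_0f'\|^2$ for $(f,f')\in A^*$, where $P_0$ is the orthogonal projection onto $\overline{\operatorname{dom}}A$, and let $\mathfrak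 H_-\supset L^2_{\mathcal H}$ be the space of bounded conjugate-linear functionals on $\mathfrak H_+$, with duality $\langle\varphi,f\rangle_{-,+}=\varphi(f)$; the symbol ${}^{\langle*\rangle}$ denotes adjoints with respect to this duality. Assume that $f(0)$ is well defined for $f\in\mathfrak H_+$, that is, if $(f,g)\in A_{\max}$ with $f$ absolutely continuous as above and $f$ represents $0\in L^2_{\mathcal H}$, then $f(0)=0$. Then $A^*=A_{\max}$; the formulas $$\Gamma_0(f,g)=\tfrac1{\sqrt2}(f(0)+f(l)),\qquad \Gamma_1(f,g)=-\tfrac1{\sqrt2}\mathcal J(f(0)-f(l))$$ define a boundary triple $\Pi=(\mathbb C^p,\Gamma_0,\Gamma_1)$ for $A^*$, i.e. $\Gamma_0,\Gamma_1$ are linear on $A^*$, $(\Gamma_0,\Gamma_1):A^*\to\mathbb C^{2p}$ is surjective, and $(f',g)-(f,g')=(\Gamma_1\hat f,\Gamma_0\hat g)-(\Gamma_0\hat f,\Gamma_1\hat g)$ for $\hat f=(f,f'),\hat g=(g,g')\in A^*$; and $Lu=\sqrt2\,\delta\otimes u$, where $\langle\delta\otimes u,f\rangle_{-,+}=f(0)^*u$,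 defines a linear operator $L:\mathbb C^p\to\mathfrak H_-$. For every $\lambda\in\mathbb C$ the problem $\mathcal JU'+\mathcal FU=\lambda\mathcal HU$ a.e. on $(0,l)$, $U(0,\lambda)=I$, has an absolutely continuous solution $U(\cdot,\lambda)$; put $U(\lambda)=U(l,\lambda)$ and $U^\#(\lambda)=U(\overline\lambda)^*$. Let $A_0=\ker\Gamma_0$, $R_\lambda=(A_0-\lambda)^{-1}$, let $\widetilde R_\lambda=(R_{\overline\lambda})^{\langle*\rangle}:\mathfrak H_-\to L^2_{\mathcal H}$ and $\widehat R_\lambda=\widetilde R_\lambda-\bigl(\tfrac12(R_i+R_{-i})\bigr)^{\langle*\rangle}$, and let, for $\lambda\in\rho(A_0)$, $\gamma(\lambda)u$ be the first component $f$ of the unique $(f,\lambda f)\in A^*$ with $\Gamma_0(f,\lambda f)=u$, and $M_\Pi(\lambda)$ the Weyl function, $M_\Pi(\lambda)\Gamma_0(f,\lambda f)=\Gamma_1(f,\lambda f)$ for $(f,\lambda f)\in A^*$. Then $\pm i\in\rho(A_0)$, and for every $\lambda\in\rho(A_0)$ the matrices $I+U(\lambda)$ and $I+U^\#(\lambda)$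 are invertible and the $\Pi\mathfrak L$-preresolvent matrix is $$\begin{bmatrix}M_\Pi(\lambda)&\gamma(\overline\lambda)^{\langle*\rangle}L\\ L^{\langle*\rangle}\gamma(\lambda)&L^{\langle*\rangle}\widehat R_\lambda L\end{bmatrix}=\begin{bmatrix}M(\lambda)&2(I+U^\#(\lambda))^{-1}\\2(I+U(\lambda))^{-1}&\mathcal J(-M(\lambda)+\operatorname{Re}M(i))\mathcal J\end{bmatrix},$$ where $M(\lambda)=-\mathcal J(I-U(\lambda))(I+U(\lambda))^{-1}$ and $\operatorname{Re}M(i)=\tfrac12(M(i)+M(i)^*)$. -/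

import Mathlib

open MeasureTheory Matrix
open scoped ComplexConjugate ComplexOrder

noncomputable section

/-! ### Linear relations in an inner product space

The inner product `(x, y)` that is linear in `x` is Mathlib's `inner ℂ y x`. -/

/-- A linear relation in `E`: a linear subspace of `E × E`. -/
abbrev LinRel (E : Type*) [NormedAddCommGroup E] [InnerProductSpace ℂ E] : Type _ :=
  Submodule ℂ (E × E)

namespace LinRel

variable {E : Type*} [NormedAddCommGroup E] [InnerProductSpace ℂ E]

/-- The domain of a linear relation. -/
def dom (T : LinRel E) : Submodule ℂ E := T.map (LinearMap.fst ℂ E E)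

/-- The range of a linear relation. -/
def ran (T : LinRel E) : Submodule ℂ E := T.map (LinearMap.snd ℂ E E)

/-- The kernel `{f | (f, 0) ∈ T}` of a linear relation. -/
def ker (T : LinRel E) : Submodule ℂ E := T.comap (LinearMap.inl ℂ E E)

/-- `T - z I = {(f, g - z f) | (f, g) ∈ T}`. -/
def shift (T : LinRel E) (z : ℂ) : LinRel E :=
  T.map ((LinearMap.fst ℂ E E).prod (LinearMap.snd ℂ E E - z • LinearMap.fst ℂ E E))

/-- The set `ρ(T)` of regular points: `ker (T - z I) = {0}` and `ran (T - z I) = E`. -/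
def resolventSet (T : LinRel E) : Set ℂ :=
  {z | ker (shift T z) = ⊥ ∧ ran (shift T z) = ⊤}

/-- The adjoint `T^* = {(u, f) | (f, v) = (u, g) for all (v, g) ∈ T}`. -/
def adj (T : LinRel E) : LinRel E where
  carrier := {x | ∀ y ∈ T, inner ℂ y.1 x.2 = inner ℂ y.2 x.1}
  add_mem' {a b} ha hb y hy := by
    simp [ha y hy, hb y hy]
  zero_mem' y _ := by simp
  smul_mem' c a ha y hy := by
    simp [ha y hy]

/-! ### The rigging `H₊ ⊂ H ⊂ H₋` associated with a symmetric relation `A` -/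

/-- The space `H₊ = dom A^*`. -/
abbrev HPlus (A : LinRel E) : Type _ := ↥(dom (adj A))

/-- The norm of `H₊`: for `(f, f') ∈ A^*`, `‖f‖₊² = ‖f‖² + ‖P₀ f'‖²`, where `P₀` is the orthogonal
projection onto the closure of `dom A`. In a Hilbert space `‖P₀ f'‖` is the distance from `f'` to
the orthogonal complement of `dom A`. -/
def plusNorm (A : LinRel E) (x : E × E) : ℝ :=
  Real.sqrt (‖x.1‖ ^ 2 + Metric.infDist x.2 ((dom A)ᗮ : Submodule ℂ E) ^ 2)

/-- The dual space `H₋`: the conjugate linear functionals on `H₊` that are bounded with respect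
to the norm of `H₊`. The duality `⟨φ, f⟩_{-,+}` is the value `φ f`. -/
def HMinus (A : LinRel E) : Submodule ℂ (HPlus A →ₗ⋆[ℂ] ℂ) where
  carrier := {φ | ∃ C : ℝ, ∀ (f : HPlus A) (f' : E), ((f : E), f') ∈ adj A →
    ‖φ f‖ ≤ C * plusNorm A ((f : E), f')}
  add_mem' := by
    rintro φ ψ ⟨C, hC⟩ ⟨D, hD⟩
    refine ⟨C + D, fun f f' h => ?_⟩
    have h1 := hC f f' h
    have h2 := hD f f' h
    have h3 := norm_add_le (φ f) (ψ f)
    rw [LinearMap.add_apply, add_mul]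
    linarith
  zero_mem' := ⟨0, fun f f' _ => by simp⟩
  smul_mem' := by
    rintro c φ ⟨C, hC⟩
    refine ⟨‖c‖ * C, fun f f' h => ?_⟩
    rw [LinearMap.smul_apply, norm_smul, mul_assoc]
    exact mul_le_mul_of_nonneg_left (hC f f' h) (norm_nonneg c)

/-- The adjoint `B^{⟨*⟩} : H₋ → H` of an operator `B : H → H₊`: the vector `x = B^{⟨*⟩} φ` is
determined by `(x, h) = ⟨φ, B h⟩_{-,+}` for all `h ∈ H`. -/
def dualAdj {A : LinRel E} (B : E → HPlus A) (φ : HMinus A) : E :=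
  Classical.epsilon fun x : E => ∀ h : E, inner ℂ h x = φ.1 (B h)

/-- The adjoint `L^{⟨*⟩} : H₊ → ℂ^p` of `L : ℂ^p → H₋`: the vector `w = L^{⟨*⟩} h` is
determined by `⟨L ξ, h⟩_{-,+} = (ξ, w) = w^* ξ` for all `ξ ∈ ℂ^p`. -/
def gaugeAdj {A : LinRel E} {p : ℕ} (L : (Fin p → ℂ) →ₗ[ℂ] HMinus A) (h : HPlus A) :
    Fin p → ℂ :=
  Classical.epsilon fun w : Fin p → ℂ => ∀ ξ : Fin p → ℂ, (L ξ).1 h = star w ⬝ᵥ ξ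

/-! ### Boundary triples -/

/-- A boundary triple `(ℂ^p, Γ₀, Γ₁)` for `A^*`, where `(u, v)_{ℂ^p} = v^* u`. -/
structure BoundaryTriple (A : LinRel E) (p : ℕ) where
  Γ₀ : adj A →ₗ[ℂ] (Fin p → ℂ)
  Γ₁ : adj A →ₗ[ℂ] (Fin p → ℂ)
  /-- Green's identity -/
  green : ∀ x y : adj A,
    inner ℂ y.1.1 x.1.2 - inner ℂ y.1.2 x.1.1 =
      star (Γ₀ y) ⬝ᵥ Γ₁ x - star (Γ₁ y) ⬝ᵥ Γ₀ x
  surjective : ∀ u v : Fin p → ℂ, ∃ x : adj A, Γ₀ x = u ∧ Γ₁ x = v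

namespace BoundaryTriple

variable {A : LinRel E} {p : ℕ} (B : BoundaryTriple A p)

/-- The selfadjoint extension `A₀ = ker Γ₀`. -/
def A₀ : LinRel E := (LinearMap.ker B.Γ₀).map (adj A).subtype

/-- The Weyl function: `M(z) Γ₀ f_z = Γ₁ f_z` for all `f_z = (f, z f) ∈ A^*`
(this determines `M(z)` for `z ∈ ρ(A₀)`). -/
def weyl (z : ℂ) : Matrix (Fin p) (Fin p) ℂ :=
  Classical.epsilon fun M : Matrix (Fin p) (Fin p) ℂ =>
    ∀ (f : E) (hf : (f, z • f) ∈ adj A), M *ᵥ B.Γ₀ ⟨(f, z • f), hf⟩ = B.Γ₁ ⟨(f, z • f), hf⟩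

/-- The `γ`-field: `γ(z) u` is the `f` with `(f, z f) ∈ A^*` and `Γ₀ (f, z f) = u`
(there is exactly one for `z ∈ ρ(A₀)`). -/
def gammaField (z : ℂ) (u : Fin p → ℂ) : HPlus A :=
  Classical.epsilon fun f : HPlus A =>
    ∃ hf : ((f : E), z • (f : E)) ∈ adj A, B.Γ₀ ⟨((f : E), z • (f : E)), hf⟩ = u

/-- The adjoint `γ(z)^{⟨*⟩} : H₋ → ℂ^p`: the vector `w = γ(z)^{⟨*⟩} φ` is determined by
`⟨φ, γ(z) ξ⟩_{-,+} = (w, ξ) = ξ^* w` for all `ξ ∈ ℂ^p`. -/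
def gammaAdj (z : ℂ) (φ : HMinus A) : Fin p → ℂ :=
  Classical.epsilon fun w : Fin p → ℂ =>
    ∀ ξ : Fin p → ℂ, φ.1 (B.gammaField z ξ) = star ξ ⬝ᵥ w

/-- The resolvent `R_z = (A₀ - z I)⁻¹ : H → H₊`: `R_z h` is the `f` with `(f, h + z f) ∈ A₀`
(there is exactly one for `z ∈ ρ(A₀)`). -/
def resolvent (z : ℂ) (h : E) : HPlus A :=
  Classical.epsilon fun f : HPlus A => ((f : E), h + z • (f : E)) ∈ B.A₀

/-- The regularizing operator `(R_i + R_{-i}) / 2 : H → H₊`. -/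
def regularizer (h : E) : HPlus A :=
  (1 / 2 : ℂ) • (B.resolvent Complex.I h + B.resolvent (-Complex.I) h)

/-- The extended resolvent `H₋ → H`, the adjoint of `R_{z̄} : H → H₊`. -/
def extResolvent (z : ℂ) (φ : HMinus A) : E := dualAdj (B.resolvent (conj z)) φ

/-- The regularized extended resolvent `H₋ → H₊`: the extended resolvent minus the adjoint of the
regularizing operator; the difference takes values in `H₊`. -/
def regExtResolvent (z : ℂ) (φ : HMinus A) : HPlus A :=
  Classical.epsilon fun f : HPlus A => (f : E) = B.extResolvent z φ - dualAdj B.regularizer φ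

/-- The preresolvent matrix of `A` corresponding to the boundary triple `B` and to the operator
`L : ℂ^p → H₋`, with the blocks `M(z)`, `γ(z̄)^{⟨*⟩} L`, `L^{⟨*⟩} γ(z)` and
`L^{⟨*⟩} R̂_z L`, where `R̂_z` is the regularized extended resolvent of `A₀`. -/
def preresolventMatrix (L : (Fin p → ℂ) →ₗ[ℂ] HMinus A) (z : ℂ) :
    Matrix (Fin p ⊕ Fin p) (Fin p ⊕ Fin p) ℂ :=
  Matrix.fromBlocks
    (B.weyl z)
    (Matrix.of fun i j => B.gammaAdj (conj z) (L (Pi.single j 1)) i)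
    (Matrix.of fun i j => gaugeAdj L (B.gammaField z (Pi.single j 1)) i)
    (Matrix.of fun i j => gaugeAdj L (B.regExtResolvent z (L (Pi.single j 1))) i)

end BoundaryTriple

end LinRel

/-! ### Canonical systems -/

/-- A canonical system `J f' + F f = z H f` on `(0, l)`. -/
structure CanonicalSystem (p : ℕ) where
  l : ℝ
  l_pos : 0 < l
  J : Matrix (Fin p) (Fin p) ℂ
  J_conjTranspose : Jᴴ = -J
  J_unitary : Jᴴ * J = 1
  F : ℝ → Matrix (Fin p) (Fin p) ℂ
  H : ℝ → Matrix (Fin p) (Fin p) ℂ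
  F_integrable : ∀ i j, IntegrableOn (fun t => F t i j) (Set.Ioo 0 l)
  H_integrable : ∀ i j, IntegrableOn (fun t => H t i j) (Set.Ioo 0 l)
  F_isHermitian : ∀ᵐ t ∂volume.restrict (Set.Ioo 0 l), (F t).IsHermitian
  H_posSemidef : ∀ᵐ t ∂volume.restrict (Set.Ioo 0 l), (H t).PosSemidef
  /-- If `f` is absolutely continuous, `J f' + F f = 0` and `H f = 0` a.e., then `f = 0`. -/
  definite : ∀ f : ℝ → Fin p → ℂ, AbsolutelyContinuousOnInterval f 0 l →
    (∀ᵐ t ∂volume.restrict (Set.Ioo 0 l), J *ᵥ deriv f t + F t *ᵥ f t = 0) →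
    (∀ᵐ t ∂volume.restrict (Set.Ioo 0 l), H t *ᵥ f t = 0) →
    ∀ t ∈ Set.Ioo 0 l, f t = 0

namespace CanonicalSystem

variable {p : ℕ} (S : CanonicalSystem p)

/-- Lebesgue measure on the interval `(0, l)`. -/
def μ : Measure ℝ := volume.restrict (Set.Ioo 0 S.l)

/-- The entry `x^* B y` of a positive semidefinite form is dominated by its diagonal. -/
theorem norm_form_le {B : Matrix (Fin p) (Fin p) ℂ} (hB : B.PosSemidef) (x y : Fin p → ℂ) :
    ‖star x ⬝ᵥ B *ᵥ y‖ ≤ ‖star x ⬝ᵥ B *ᵥ x‖ + ‖star y ⬝ᵥ B *ᵥ y‖ := by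
  have hsym : star y ⬝ᵥ B *ᵥ x = conj (star x ⬝ᵥ B *ᵥ y) := by
    rw [starRingEnd_apply, ← star_dotProduct_star, star_star, star_mulVec, hB.1.eq,
      dotProduct_mulVec]
  have h1 := fun c : ℂ => (Complex.le_def.1 (hB.dotProduct_mulVec_nonneg (x + c • y))).1
  have e : ∀ c : ℂ, star (x + c • y) ⬝ᵥ B *ᵥ (x + c • y) =
      star x ⬝ᵥ B *ᵥ x + c * (star x ⬝ᵥ B *ᵥ y) + conj c * conj (star x ⬝ᵥ B *ᵥ y)
        + conj c * c * (star y ⬝ᵥ B *ᵥ y) := by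
    intro c
    rw [← hsym]
    simp only [star_add, star_smul, mulVec_add, mulVec_smul, dotProduct_add, add_dotProduct,
      smul_dotProduct, dotProduct_smul, smul_eq_mul, starRingEnd_apply]
    ring
  simp only [e] at h1
  have a1 := h1 1
  have a2 := h1 (-1)
  have a3 := h1 Complex.I
  have a4 := h1 (-Complex.I)
  simp at a1 a2 a3 a4
  have b1 := Complex.norm_le_abs_re_add_abs_im (star x ⬝ᵥ B *ᵥ y)
  have b2 := Complex.re_le_norm (star x ⬝ᵥ B *ᵥ x)
  have b3 := Complex.re_le_norm (star y ⬝ᵥ B *ᵥ y)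
  have b4 : |(star x ⬝ᵥ B *ᵥ y).re| ≤
      ((star x ⬝ᵥ B *ᵥ x).re + (star y ⬝ᵥ B *ᵥ y).re) / 2 := by
    rw [abs_le]; constructor <;> linarith
  have b5 : |(star x ⬝ᵥ B *ᵥ y).im| ≤
      ((star x ⬝ᵥ B *ᵥ x).re + (star y ⬝ᵥ B *ᵥ y).re) / 2 := by
    rw [abs_le]; constructor <;> linarith
  linarith

theorem aestronglyMeasurable_form {f g : ℝ → Fin p → ℂ}
    (hf : AEStronglyMeasurable f S.μ) (hg : AEStronglyMeasurable g S.μ) :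
    AEStronglyMeasurable (fun t => star (f t) ⬝ᵥ S.H t *ᵥ g t) S.μ := by
  have hf' : ∀ i, AEStronglyMeasurable (fun t => f t i) S.μ := fun i =>
    (continuous_apply i).comp_aestronglyMeasurable hf
  have hg' : ∀ i, AEStronglyMeasurable (fun t => g t i) S.μ := fun i =>
    (continuous_apply i).comp_aestronglyMeasurable hg
  simp only [dotProduct, mulVec, Pi.star_apply]
  refine Finset.aestronglyMeasurable_fun_sum _ fun i _ => ?_
  refine (hf' i).star.mul (Finset.aestronglyMeasurable_fun_sum _ fun j _ => ?_)
  exact (S.H_integrable i j).aestronglyMeasurable.mul (hg' j)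

theorem integrable_form {f g : ℝ → Fin p → ℂ}
    (hf : AEStronglyMeasurable f S.μ) (hg : AEStronglyMeasurable g S.μ)
    (hf' : Integrable (fun t => star (f t) ⬝ᵥ S.H t *ᵥ f t) S.μ)
    (hg' : Integrable (fun t => star (g t) ⬝ᵥ S.H t *ᵥ g t) S.μ) :
    Integrable (fun t => star (f t) ⬝ᵥ S.H t *ᵥ g t) S.μ := by
  refine (hf'.norm.add hg'.norm).mono' (S.aestronglyMeasurable_form hf hg) ?_
  filter_upwards [S.H_posSemidef] with t ht
  exact norm_form_le ht _ _

/-- The space `𝓛²_H(0, l)` of measurable `ℂ^p`-valued functions on `(0, l)` with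
`∫ f^* H f < ∞`, as a space of functions (values outside `(0, l)` play no role). -/
def squareIntegrable : Submodule ℂ (ℝ → Fin p → ℂ) where
  carrier := {f | AEStronglyMeasurable f S.μ ∧
    Integrable (fun t => star (f t) ⬝ᵥ S.H t *ᵥ f t) S.μ}
  add_mem' := by
    rintro f g ⟨hf, hf'⟩ ⟨hg, hg'⟩
    refine ⟨hf.add hg, ?_⟩
    have h := ((hf'.add (S.integrable_form hf hg hf' hg')).add
      (S.integrable_form hg hf hg' hf')).add hg'
    refine h.congr (Filter.Eventually.of_forall fun t => ?_)
    simp only [Pi.add_apply, star_add, mulVec_add, dotProduct_add, add_dotProduct]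
    ring
  zero_mem' := ⟨aestronglyMeasurable_zero, by simp⟩
  smul_mem' := by
    rintro c f ⟨hf, hf'⟩
    refine ⟨hf.const_smul c, ?_⟩
    refine (hf'.const_mul (conj c * c)).congr (Filter.Eventually.of_forall fun t => ?_)
    simp only [Pi.smul_apply, star_smul, mulVec_smul, dotProduct_smul, smul_dotProduct,
      smul_eq_mul, starRingEnd_apply]
    ring

/-- The semi-Hilbert space `𝓛²_H(0, l)`, as a type of its own. -/
def PreL2 : Type := ↥S.squareIntegrable

instance : AddCommGroup S.PreL2 := inferInstanceAs (AddCommGroup ↥S.squareIntegrable)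

instance : Module ℂ S.PreL2 := inferInstanceAs (Module ℂ ↥S.squareIntegrable)

instance : CoeFun S.PreL2 (fun _ => ℝ → Fin p → ℂ) := ⟨fun f => f.val⟩

/-- The semi-definite inner product `∫ f^* H g`, linear in `g`. -/
@[reducible]
def preInner : PreInnerProductSpace.Core ℂ S.PreL2 where
  inner f g := ∫ t, star (f t) ⬝ᵥ S.H t *ᵥ g t ∂S.μ
  conj_inner_symm f g := by
    rw [← integral_conj]
    refine integral_congr_ae ?_
    filter_upwards [S.H_posSemidef] with t ht
    rw [starRingEnd_apply, ← star_dotProduct_star, star_star, star_mulVec, ht.1.eq,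
      dotProduct_mulVec]
  re_inner_nonneg f := by
    rw [← integral_re f.2.2]
    refine integral_nonneg_of_ae ?_
    filter_upwards [S.H_posSemidef] with t ht
    exact (Complex.le_def.1 (ht.dotProduct_mulVec_nonneg (f t))).1
  add_left f g h := by
    rw [← integral_add (S.integrable_form f.2.1 h.2.1 f.2.2 h.2.2)
      (S.integrable_form g.2.1 h.2.1 g.2.2 h.2.2)]
    refine integral_congr_ae (Filter.Eventually.of_forall fun t => ?_)
    change star (f t + g t) ⬝ᵥ _ = _
    simp only [star_add, add_dotProduct]
  smul_left f g c := by
    rw [← integral_const_mul]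
    refine integral_congr_ae (Filter.Eventually.of_forall fun t => ?_)
    change star (c • f t) ⬝ᵥ _ = _
    simp only [star_smul, smul_dotProduct, smul_eq_mul, starRingEnd_apply]

instance : SeminormedAddCommGroup S.PreL2 :=
  InnerProductSpace.Core.toSeminormedAddCommGroup (c := S.preInner)

instance : InnerProductSpace ℂ S.PreL2 := InnerProductSpace.ofCore S.preInner

/-- The Hilbert space `L²_H(0, l)`: the quotient of `𝓛²_H(0, l)` by the functions of norm `0`. -/
abbrev L2 : Type := SeparationQuotient S.PreL2

/-- The class in `L²_H(0, l)` of a function. -/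
def cls (f : S.PreL2) : S.L2 := SeparationQuotient.mk f

/-- `f` is absolutely continuous on `[0, l]` and `J f' + F f = H g` a.e. on `(0, l)`.
(Absolutely continuous functions are differentiable a.e., so the clause on differentiability
is automatic.) -/
def IsSolution (f g : ℝ → Fin p → ℂ) : Prop :=
  AbsolutelyContinuousOnInterval f 0 S.l ∧
    ∀ᵐ t ∂S.μ, DifferentiableAt ℝ f t ∧ S.J *ᵥ deriv f t + S.F t *ᵥ f t = S.H t *ᵥ g t

variable {S} in
theorem IsSolution.add {f g f' g' : ℝ → Fin p → ℂ} (h : S.IsSolution f g)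
    (h' : S.IsSolution f' g') : S.IsSolution (f + f') (g + g') := by
  refine ⟨h.1.add h'.1, ?_⟩
  filter_upwards [h.2, h'.2] with t ⟨d, e⟩ ⟨d', e'⟩
  refine ⟨d.add d', ?_⟩
  rw [deriv_add d d', Pi.add_apply, Pi.add_apply, mulVec_add, mulVec_add, mulVec_add, ← e, ← e']
  abel

variable {S} in
theorem IsSolution.smul {f g : ℝ → Fin p → ℂ} (c : ℂ) (h : S.IsSolution f g) :
    S.IsSolution (c • f) (c • g) := by
  refine ⟨h.1.const_smul c, ?_⟩
  filter_upwards [h.2] with t ⟨d, e⟩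
  refine ⟨d.const_smul c, ?_⟩
  rw [deriv_const_smul c d, Pi.smul_apply, Pi.smul_apply, mulVec_smul, mulVec_smul, mulVec_smul,
    ← e, smul_add]

theorem isSolution_zero : S.IsSolution 0 0 := by
  refine ⟨?_, Filter.Eventually.of_forall fun t => ⟨differentiableAt_const _, ?_⟩⟩
  · exact (LipschitzWith.const (0 : Fin p → ℂ)).lipschitzOnWith.absolutelyContinuousOnInterval
  · simp

/-- The maximal relation `A_max`. -/
def maxRel : LinRel S.L2 where
  carrier := {x | ∃ f g : S.PreL2, S.IsSolution f g ∧ x = (S.cls f, S.cls g)}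
  add_mem' := by
    rintro _ _ ⟨f, g, h, rfl⟩ ⟨f', g', h', rfl⟩
    exact ⟨f + f', g + g', h.add h', rfl⟩
  zero_mem' := ⟨0, 0, S.isSolution_zero, rfl⟩
  smul_mem' := by
    rintro c _ ⟨f, g, h, rfl⟩
    exact ⟨c • f, c • g, h.smul c, rfl⟩

/-- The preminimal relation `A'`: the restriction of `A_max` to the pairs whose first component
has compact support in `(0, l)`. -/
def preminRel : LinRel S.L2 where
  carrier := {x | ∃ f g : S.PreL2, S.IsSolution f g ∧
    (∃ a b : ℝ, 0 < a ∧ b < S.l ∧ ∀ t ∈ Set.Icc 0 S.l, t ∉ Set.Icc a b → f t = 0) ∧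
    x = (S.cls f, S.cls g)}
  add_mem' := by
    rintro _ _ ⟨f, g, h, ⟨a, b, ha, hb, hf⟩, rfl⟩ ⟨f', g', h', ⟨a', b', ha', hb', hf'⟩, rfl⟩
    refine ⟨f + f', g + g', h.add h', ⟨min a a', max b b', lt_min ha ha', max_lt hb hb', ?_⟩, rfl⟩
    intro t ht hn
    have e1 : f t = 0 := hf t ht fun h1 =>
      hn ⟨(min_le_left _ _).trans h1.1, h1.2.trans (le_max_left _ _)⟩
    have e2 : f' t = 0 := hf' t ht fun h1 =>
      hn ⟨(min_le_right _ _).trans h1.1, h1.2.trans (le_max_right _ _)⟩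
    change f t + f' t = 0
    rw [e1, e2, add_zero]
  zero_mem' := ⟨0, 0, S.isSolution_zero,
    ⟨S.l / 2, S.l / 2, half_pos S.l_pos, half_lt_self S.l_pos, fun _ _ _ => rfl⟩, rfl⟩
  smul_mem' := by
    rintro c _ ⟨f, g, h, ⟨a, b, ha, hb, hf⟩, rfl⟩
    refine ⟨c • f, c • g, h.smul c, ⟨a, b, ha, hb, fun t ht hn => ?_⟩, rfl⟩
    change c • f t = 0
    rw [hf t ht hn, smul_zero]

/-- The minimal relation `A = A_min`, the closure of the preminimal relation. -/
def minRel : LinRel S.L2 := S.preminRel.topologicalClosure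

/-- `U = U(·, z)` is the fundamental matrix solution: `J U' + F U = z H U` a.e. on `(0, l)` and
`U(0) = I` (the matrix equation is stated for `U c` with arbitrary `c ∈ ℂ^p`). -/
def IsFundamentalMatrix (z : ℂ) (U : ℝ → Matrix (Fin p) (Fin p) ℂ) : Prop :=
  U 0 = 1 ∧ ∀ c : Fin p → ℂ, S.IsSolution (fun t => U t *ᵥ c) (fun t => z • (U t *ᵥ c))

/-- The boundary triple
`Γ₀ (f, g) = (f(0) + f(l)) / √2`, `Γ₁ (f, g) = - J (f(0) - f(l)) / √2`,
where `f` is the absolutely continuous representative with `J f' + F f = H g`. -/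
def IsCanonicalTriple (B : LinRel.BoundaryTriple S.minRel p) : Prop :=
  ∀ f g : S.PreL2, S.IsSolution f g → ∀ h : (S.cls f, S.cls g) ∈ LinRel.adj S.minRel,
    B.Γ₀ ⟨(S.cls f, S.cls g), h⟩ = (1 / (Real.sqrt 2 : ℂ)) • (f 0 + f S.l) ∧
    B.Γ₁ ⟨(S.cls f, S.cls g), h⟩ = -((1 / (Real.sqrt 2 : ℂ)) • S.J *ᵥ (f 0 - f S.l))

/-- The value `f(0)` is well defined for `f ∈ H₊ = dom A_max`: an absolutely continuous `f` that
occurs in `A_max` and represents the zero class of `L²_H(0, l)` vanishes at `0`. -/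
def EvalWellDefined : Prop :=
  ∀ f g : S.PreL2, S.IsSolution f g → S.cls f = 0 → f 0 = 0

/-- `L : ℂ^p → H₋` is the operator `L u = √2 δ ⊗ u`, where `⟨δ ⊗ u, f⟩_{-,+} = f(0)^* u`. -/
def IsGaugeMap (L : (Fin p → ℂ) →ₗ[ℂ] LinRel.HMinus S.minRel) : Prop :=
  ∀ (u : Fin p → ℂ) (f g : S.PreL2), S.IsSolution f g →
    ∀ h : S.cls f ∈ LinRel.dom (LinRel.adj S.minRel),
      (L u).1 ⟨S.cls f, h⟩ = (Real.sqrt 2 : ℂ) * (star (f 0) ⬝ᵥ u)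

end CanonicalSystem

end

/-! The engine is Lagrange's identity: for two solution pairs `(f, g)` and `(φ, ψ)`, the difference
`(g, φ) - (f, ψ)` equals the boundary term `φ^* J f` taken between `0` and `l`. With existence for
initial value problems (Carathéodory) and definiteness, it reduces the theorem to linear algebra in
`ℂ^p`.

Adjoint. Boundary terms against compactly supported `φ` vanish, so `A_max ⊆ A^*`. Conversely, given
`(f, g) ∈ A^*`, let `h` solve the equation with right-hand side `g`. On `[a, b]` remove from `f - h`
its projection onto the homogeneous solutions. The remainder is orthogonal to them, hence is the
right-hand side of a solution supported in `[a, b]`; testing the adjoint relation against that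
solution shows that the remainder has norm zero. Definiteness glues the resulting constants as `[a,
b]` grows.

Triple and `L`. Green's identity is Lagrange's identity in other coordinates; surjectivity holds
because the Gram matrix of the homogeneous solutions is injective. Lagrange's identity against fixed
test pairs bounds `f(0)` by the graph norm. Since `f(0)` depends on the class of `f` alone, the
second component may be varied modulo `(dom A)ᗮ`, which gives a bound by the norm of `H₊`.

Matrix. The pairs `(f, z f) ∈ A^*` are the `U(·, z) c`, and `Γ₀` turns `c` into `(1 + U(z)) c / √2`.
Hence `ρ(A₀)` is where `1 + U(z)` is invertible, and the Weyl function and both off-diagonal blocks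
can be read off. For the last block, the extended resolvent maps `L u` to the homogeneous solution
`y` with `y(0) + y(l) = -√2 J u`, so applying the adjoint of `L` amounts to reading `√2 y(0)`. The
closed form then follows from `M = J - 2 J (1 + U)⁻¹` and from `M(i)^* = M(-i)`, a consequence of
`U(z̄)^* J U(z) = J`. -/

noncomputable section

/-! ### Absolute continuity and Carathéodory's existence theorem -/

section AbsolutelyContinuous

variable {E : Type*} [NormedAddCommGroup E]

theorem AbsolutelyContinuousOnInterval.of_dist_le {X Y : Type*} [PseudoMetricSpace X]
    [PseudoMetricSpace Y] {f : ℝ → X} {g : ℝ → Y} {a b K : ℝ}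
    (hg : AbsolutelyContinuousOnInterval g a b)
    (h : ∀ s ∈ Set.uIcc a b, ∀ t ∈ Set.uIcc a b, dist (f s) (f t) ≤ K * dist (g s) (g t)) :
    AbsolutelyContinuousOnInterval f a b := by
  have h0 := Filter.Tendsto.const_mul K hg
  rw [mul_zero] at h0
  refine squeeze_zero' (Filter.Eventually.of_forall fun t =>
    Finset.sum_nonneg fun i _ => dist_nonneg) ?_ h0
  refine Filter.Eventually.filter_mono inf_le_right (Filter.eventually_principal.2 ?_)
  intro I hI
  rw [Finset.mul_sum]
  exact Finset.sum_le_sum fun i hi => h _ (hI.1 i hi).1 _ (hI.1 i hi).2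

variable [NormedSpace ℝ E]

/-- Increments of the primitive are dominated by those of the primitive of the real function `‖f‖`,
for which the scalar result applies. -/
theorem IntervalIntegrable.absolutelyContinuousOnInterval_integral {f : ℝ → E} {a b : ℝ} (hf : IntervalIntegrable f volume a b) :
    AbsolutelyContinuousOnInterval (fun x => ∫ t in a..x, f t) a b := by
  have h := hf.norm.absolutelyContinuousOnInterval_intervalIntegral (Set.left_mem_uIcc)
  refine h.of_dist_le (K := 1) fun s hs t ht => ?_
  have hi : ∀ x ∈ Set.uIcc a b, IntervalIntegrable f volume a x := fun x hx =>
    hf.mono_set (Set.uIcc_subset_uIcc_left hx)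
  rw [one_mul, dist_eq_norm, Real.dist_eq, intervalIntegral.integral_interval_sub_left (hi s hs)
    (hi t ht), intervalIntegral.integral_interval_sub_left (hi s hs).norm (hi t ht).norm]
  exact intervalIntegral.norm_integral_le_abs_integral_norm

/-- The difference of `f` and the primitive of `g` is absolutely continuous with derivative zero
a.e., hence constant. -/
theorem AbsolutelyContinuousOnInterval.integral_eq_sub_of_ae_hasDerivAt [CompleteSpace E]
    {f g : ℝ → E} {a b : ℝ} (hab : a ≤ b)
    (hf : AbsolutelyContinuousOnInterval f a b) (hg : IntervalIntegrable g volume a b)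
    (h : ∀ᵐ t ∂volume.restrict (Set.Ioo a b), HasDerivAt f (g t) t) :
    ∫ t in a..b, g t = f b - f a := by
  have hA := hf.sub (hg.absolutelyContinuousOnInterval_integral)
  have h' : ∀ᵐ t, t ∈ Set.uIcc a b → HasDerivAt (f - fun x => ∫ t in a..x, g t) 0 t := by
    rw [ae_restrict_iff' measurableSet_Ioo] at h
    have ha : ∀ᵐ t : ℝ, t ≠ a := by simp [ae_iff, measure_singleton]
    have hb : ∀ᵐ t : ℝ, t ≠ b := by simp [ae_iff, measure_singleton]
    filter_upwards [h, hg.ae_hasDerivAt_integral, ha, hb] with t h1 h2 h3 h4 h5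
    have h6 : t ∈ Set.Ioo a b := by
      rw [Set.uIcc_of_le hab] at h5
      exact ⟨lt_of_le_of_ne h5.1 h3.symm, lt_of_le_of_ne h5.2 h4⟩
    have := (h1 h6).sub (h2 h5 a Set.left_mem_uIcc)
    rwa [sub_self] at this
  obtain ⟨C, hC⟩ := hA.const_of_ae_hasDerivAt_zero h'
  have h1 := hC a Set.left_mem_uIcc
  have h2 := hC b Set.right_mem_uIcc
  simp only [Pi.sub_apply, intervalIntegral.integral_same, sub_zero] at h1 h2
  rw [h1, ← h2]; abel

/-- With `P` the primitive of `m`, the integrand is half the derivative of `exp (2 P)`, which is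
absolutely continuous because `exp` is Lipschitz on half-lines bounded above. The factor `1/2`
becomes the contraction constant of the Picard operator. -/
theorem integral_mul_exp_integral_le {m : ℝ → ℝ} {l : ℝ}
    (hm : IntervalIntegrable m volume 0 l) (hm0 : ∀ t, 0 ≤ m t) {t : ℝ} (ht : t ∈ Set.Icc 0 l) :
    ∫ s in (0 : ℝ)..t, m s * Real.exp (2 * ∫ r in (0 : ℝ)..s, m r) ≤
      Real.exp (2 * ∫ r in (0 : ℝ)..t, m r) / 2 := by
  have hmt : IntervalIntegrable m volume 0 t := hm.mono_set
    (Set.uIcc_subset_uIcc_left (by rwa [Set.uIcc_of_le (ht.1.trans ht.2)]))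
  have hAC := hmt.absolutelyContinuousOnInterval_integral
  have hnn : ∀ s ∈ Set.uIcc 0 t, (∫ r in (0 : ℝ)..s, m r) ≤ ∫ r in (0 : ℝ)..t, m r := by
    intro s hs
    rw [Set.uIcc_of_le ht.1] at hs
    exact intervalIntegral.integral_mono_interval le_rfl hs.1 hs.2
      (Filter.Eventually.of_forall hm0) hmt
  set P : ℝ → ℝ := fun s => ∫ r in (0 : ℝ)..s, m r with hP
  have hexp : AbsolutelyContinuousOnInterval (fun s => Real.exp (2 * P s)) 0 t := by
    refine hAC.of_dist_le (K := 2 * Real.exp (2 * P t)) fun s hs r hr => ?_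
    have hd : ∀ x ∈ Set.Iic (P t), HasDerivWithinAt (fun y => Real.exp (2 * y))
        (Real.exp (2 * x) * (2 * 1)) (Set.Iic (P t)) x := fun x _ =>
      (((hasDerivAt_id x).const_mul 2).exp).hasDerivWithinAt
    have hb : ∀ x ∈ Set.Iic (P t), ‖Real.exp (2 * x) * (2 * 1)‖ ≤ 2 * Real.exp (2 * P t) := by
      intro x hx
      rw [Real.norm_of_nonneg (by positivity)]
      have : Real.exp (2 * x) ≤ Real.exp (2 * P t) := Real.exp_le_exp.2 (by
        have : x ≤ P t := hx
        linarith)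
      linarith
    have := (convex_Iic (P t)).norm_image_sub_le_of_norm_hasDerivWithin_le hd hb
      (hnn r hr) (hnn s hs)
    rwa [← dist_eq_norm, ← dist_eq_norm] at this
  have hint : IntervalIntegrable (fun s => m s * Real.exp (2 * P s)) volume 0 t :=
    hmt.mul_continuousOn hexp.continuousOn
  have hder : ∀ᵐ s ∂volume.restrict (Set.Ioo 0 t), HasDerivAt (fun s => Real.exp (2 * P s))
      (2 * (m s * Real.exp (2 * P s))) s := by
    rw [ae_restrict_iff' measurableSet_Ioo]
    filter_upwards [hmt.ae_hasDerivAt_integral] with s hs h1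
    have h2 := hs (by rw [Set.uIcc_of_le ht.1]; exact Set.Ioo_subset_Icc_self h1) 0 Set.left_mem_uIcc
    have h3 := (h2.const_mul 2).exp
    convert h3 using 1
    ring
  have := hexp.integral_eq_sub_of_ae_hasDerivAt ht.1 (hint.const_mul 2) hder
  rw [intervalIntegral.integral_const_mul] at this
  simp only [hP, intervalIntegral.integral_same, mul_zero, Real.exp_zero] at this
  linarith

/-- Carathéodory's existence theorem for a right-hand side that is Lipschitz in the state, with an
integrable Lipschitz constant. -/
theorem exists_absolutelyContinuousOnInterval_ae_hasDerivAt [CompleteSpace E]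
    {l : ℝ} (hl : 0 < l) {m : ℝ → ℝ} (hm : IntervalIntegrable m volume 0 l) (hm0 : ∀ t, 0 ≤ m t)
    {h : ℝ → E → E} (hlip : ∀ t u v, ‖h t u - h t v‖ ≤ m t * ‖u - v‖)
    (hint : ∀ y : ℝ → E, ContinuousOn y (Set.Icc 0 l) →
      IntervalIntegrable (fun t => h t (y t)) volume 0 l) (c : E) :
    ∃ y : ℝ → E, AbsolutelyContinuousOnInterval y 0 l ∧ y 0 = c ∧
      ∀ᵐ t ∂volume.restrict (Set.Ioo 0 l), HasDerivAt y (h t (y t)) t := by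
  set P : ℝ → ℝ := fun s => ∫ r in (0 : ℝ)..s, m r with hP
  have hI : Set.uIcc 0 l = Set.Icc 0 l := Set.uIcc_of_le hl.le
  have hPc : ContinuousOn P (Set.Icc 0 l) :=
    hI ▸ (hm.absolutelyContinuousOnInterval_integral).continuousOn
  -- Bielecki's weight: a state `y` is encoded as `x = exp (-2 P) y`, so that the sup norm of `x` is
  -- a weighted norm of `y`. The Picard operator then contracts on all of `[0, l]` at once, without
  -- iteration over short intervals.
  let ext : C(Set.Icc (0 : ℝ) l, E) → ℝ → E := fun x s =>
    Real.exp (2 * P s) • Set.IccExtend hl.le x s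
  have hextc : ∀ x, ContinuousOn (ext x) (Set.Icc 0 l) := fun x =>
    (Real.continuous_exp.comp_continuousOn (hPc.const_mul 2)).smul
      (x.continuous.Icc_extend').continuousOn
  have hexti : ∀ x, IntervalIntegrable (fun s => h s (ext x s)) volume 0 l := fun x =>
    hint _ (hextc x)
  let Y : C(Set.Icc (0 : ℝ) l, E) → ℝ → E := fun x t => c + ∫ s in (0 : ℝ)..t, h s (ext x s)
  have hYac : ∀ x, AbsolutelyContinuousOnInterval (Y x) 0 l := fun x =>
    ((hexti x).absolutelyContinuousOnInterval_integral).of_dist_le (K := 1)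
      fun s _ t _ => by simp [Y, dist_eq_norm]
  have hYc : ∀ x, ContinuousOn (Y x) (Set.Icc 0 l) := fun x => hI ▸ (hYac x).continuousOn
  let T : C(Set.Icc (0 : ℝ) l, E) → C(Set.Icc (0 : ℝ) l, E) := fun x =>
    ⟨fun t => Real.exp (-(2 * P t)) • Y x t, by
      have : ContinuousOn (fun t => Real.exp (-(2 * P t)) • Y x t) (Set.Icc 0 l) :=
        (Real.continuous_exp.comp_continuousOn (hPc.const_mul 2).neg).smul (hYc x)
      exact continuousOn_iff_continuous_domRestrict.1 this⟩
  have hT : ContractingWith (1 / 2) T := by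
    refine ⟨by norm_num, LipschitzWith.of_dist_le_mul fun x x' => ?_⟩
    rw [ContinuousMap.dist_le (by positivity)]
    rintro ⟨t, ht⟩
    have hsub : Set.uIcc 0 t ⊆ Set.uIcc 0 l := Set.uIcc_subset_uIcc_left (by rwa [hI])
    have i1 := (hexti x).mono_set hsub
    have i2 := (hexti x').mono_set hsub
    have e1 : dist (T x ⟨t, ht⟩) (T x' ⟨t, ht⟩) = Real.exp (-(2 * P t)) *
        ‖∫ s in (0 : ℝ)..t, (h s (ext x s) - h s (ext x' s))‖ := by
      rw [intervalIntegral.integral_sub i1 i2, dist_eq_norm]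
      change ‖Real.exp (-(2 * P t)) • (c + _) - Real.exp (-(2 * P t)) • (c + _)‖ = _
      rw [← smul_sub, norm_smul, Real.norm_of_nonneg (Real.exp_pos _).le, add_sub_add_left_eq_sub]
    have hmi : IntervalIntegrable (fun s => m s * Real.exp (2 * P s)) volume 0 t := by
      refine (hm.mono_set hsub).mul_continuousOn ?_
      refine Real.continuous_exp.comp_continuousOn ((hPc.mono ?_).const_mul 2)
      rwa [← hI]
    have e2 : ‖∫ s in (0 : ℝ)..t, (h s (ext x s) - h s (ext x' s))‖ ≤
        ∫ s in (0 : ℝ)..t, m s * Real.exp (2 * P s) * dist x x' := by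
      refine intervalIntegral.norm_integral_le_of_norm_le ht.1
        (Filter.Eventually.of_forall fun s _ => ?_) (hmi.mul_const _)
      refine (hlip _ _ _).trans ?_
      rw [mul_assoc]
      refine mul_le_mul_of_nonneg_left ?_ (hm0 s)
      change ‖Real.exp (2 * P s) • _ - Real.exp (2 * P s) • _‖ ≤ _
      rw [← smul_sub, norm_smul, Real.norm_of_nonneg (Real.exp_pos _).le, ← dist_eq_norm]
      exact mul_le_mul_of_nonneg_left (ContinuousMap.dist_apply_le_dist _) (Real.exp_pos _).le
    rw [intervalIntegral.integral_mul_const] at e2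
    have e3 := integral_mul_exp_integral_le hm hm0 ht
    rw [e1]
    have e4 : ‖∫ s in (0 : ℝ)..t, (h s (ext x s) - h s (ext x' s))‖ ≤
        Real.exp (2 * P t) / 2 * dist x x' :=
      e2.trans (mul_le_mul_of_nonneg_right e3 dist_nonneg)
    refine (mul_le_mul_of_nonneg_left e4 (Real.exp_pos _).le).trans (le_of_eq ?_)
    rw [Real.exp_neg]
    have := (Real.exp_pos (2 * P t)).ne'
    field_simp
    simp only [NNReal.coe_div, NNReal.coe_one, NNReal.coe_ofNat]
    ring
  have hfix := hT.fixedPoint_isFixedPt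
  set x := ContractingWith.fixedPoint T hT
  refine ⟨Y x, hYac x, by simp [Y], ?_⟩
  have hxY : ∀ t ∈ Set.Icc 0 l, ext x t = Y x t := by
    intro t ht
    have h1 : x ⟨t, ht⟩ = Real.exp (-(2 * P t)) • Y x t := by
      conv_lhs => rw [← hfix]
      rfl
    change Real.exp (2 * P t) • Set.IccExtend hl.le x t = _
    rw [Set.IccExtend_of_mem _ _ ht, h1, smul_smul, ← Real.exp_add]
    simp
  rw [ae_restrict_iff' measurableSet_Ioo]
  filter_upwards [(hexti x).ae_hasDerivAt_integral] with t h1 h2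
  have h3 := Set.Ioo_subset_Icc_self h2
  rw [← hxY t h3]
  exact (h1 (by rwa [hI]) 0 Set.left_mem_uIcc).const_add c

end AbsolutelyContinuous

/-! ### Sesquilinear expressions in vector functions -/

section MatrixVector

variable {p : ℕ}

theorem norm_mulVec_le_sum (A : Matrix (Fin p) (Fin p) ℂ) (v : Fin p → ℂ) :
    ‖A *ᵥ v‖ ≤ (∑ i, ∑ j, ‖A i j‖) * ‖v‖ := by
  refine (pi_norm_le_iff_of_nonneg (by positivity)).2 fun i => ?_
  calc ‖(A *ᵥ v) i‖ ≤ ∑ j, ‖A i j * v j‖ := by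
        simp only [mulVec, dotProduct]
        exact norm_sum_le _ _
    _ ≤ ∑ j, ‖A i j‖ * ‖v‖ := Finset.sum_le_sum fun j _ => by
        rw [norm_mul]
        exact mul_le_mul_of_nonneg_left (norm_le_pi_norm v j) (norm_nonneg _)
    _ = (∑ j, ‖A i j‖) * ‖v‖ := (Finset.sum_mul _ _ _).symm
    _ ≤ _ := mul_le_mul_of_nonneg_right
        (Finset.single_le_sum (f := fun i => ∑ j, ‖A i j‖) (fun i _ => by positivity)
          (Finset.mem_univ i)) (norm_nonneg _)

theorem star_mulVec_dotProduct (A : Matrix (Fin p) (Fin p) ℂ) (u v : Fin p → ℂ) :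
    star (A *ᵥ u) ⬝ᵥ v = star u ⬝ᵥ Aᴴ *ᵥ v := by
  rw [star_mulVec, dotProduct_mulVec]

theorem eq_zero_of_forall_star_dotProduct {v : Fin p → ℂ} (h : ∀ u, star u ⬝ᵥ v = 0) : v = 0 := by
  ext i
  simpa using h (Pi.single i 1)

theorem absolutelyContinuousOnInterval_finset_sum {E ι : Type*} [NormedAddCommGroup E]
    {a b : ℝ} (s : Finset ι) {f : ι → ℝ → E}
    (h : ∀ i ∈ s, AbsolutelyContinuousOnInterval (f i) a b) :
    AbsolutelyContinuousOnInterval (fun t => ∑ i ∈ s, f i t) a b := by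
  classical
  induction s using Finset.induction_on with
  | empty =>
    simpa using (LipschitzWith.const (0 : E)).lipschitzOnWith.absolutelyContinuousOnInterval
  | insert i s hi ih =>
    simp only [Finset.sum_insert hi]
    exact (h i (Finset.mem_insert_self i s)).fun_add
      (ih fun j hj => h j (Finset.mem_insert_of_mem hj))

theorem AbsolutelyContinuousOnInterval.star_dotProduct_mulVec {a b : ℝ} {f g : ℝ → Fin p → ℂ}
    (A : Matrix (Fin p) (Fin p) ℂ) (hf : AbsolutelyContinuousOnInterval f a b)
    (hg : AbsolutelyContinuousOnInterval g a b) :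
    AbsolutelyContinuousOnInterval (fun t => star (f t) ⬝ᵥ A *ᵥ g t) a b := by
  refine absolutelyContinuousOnInterval_finset_sum _ fun i _ => ?_
  refine AbsolutelyContinuousOnInterval.fun_smul (f := fun t => star (f t) i)
    (g := fun t => (A *ᵥ g t) i) ?_ ?_
  · refine hf.of_dist_le (K := 1) fun s _ t _ => ?_
    rw [one_mul, Pi.star_apply, Pi.star_apply, dist_eq_norm, ← star_sub, norm_star, ← dist_eq_norm]
    exact dist_le_pi_dist _ _ _
  · refine hg.of_dist_le (K := ∑ i, ∑ j, ‖A i j‖) fun s _ t _ => ?_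
    rw [dist_eq_norm, dist_eq_norm, ← Pi.sub_apply, ← mulVec_sub]
    exact (norm_le_pi_norm _ i).trans (norm_mulVec_le_sum _ _)

theorem HasDerivAt.star_dotProduct_mulVec {f g : ℝ → Fin p → ℂ} {f' g' : Fin p → ℂ} {t : ℝ}
    (A : Matrix (Fin p) (Fin p) ℂ) (hf : HasDerivAt f f' t) (hg : HasDerivAt g g' t) :
    HasDerivAt (fun t => star (f t) ⬝ᵥ A *ᵥ g t) (star f' ⬝ᵥ A *ᵥ g t + star (f t) ⬝ᵥ A *ᵥ g') t := by
  have hf' := hasDerivAt_pi.1 hf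
  have hg' := hasDerivAt_pi.1 hg
  simp only [dotProduct, mulVec, ← Finset.sum_add_distrib, Pi.star_apply]
  refine HasDerivAt.fun_sum fun i _ => ?_
  exact (hf' i).star.mul (HasDerivAt.fun_sum fun j _ => (hg' j).const_mul (A i j))

end MatrixVector

/-! ### Initial value problems, Lagrange's identity, fundamental matrices -/

namespace CanonicalSystem

variable {p : ℕ} (S : CanonicalSystem p)

theorem J_mul_J : S.J * S.J = -1 := by
  have h := S.J_unitary
  rw [S.J_conjTranspose, neg_mul] at h
  rw [← h, neg_neg]

theorem J_mulVec_J_mulVec (v : Fin p → ℂ) : S.J *ᵥ S.J *ᵥ v = -v := by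
  rw [mulVec_mulVec, J_mul_J, neg_mulVec, one_mulVec]

theorem uIcc_zero_l : Set.uIcc 0 S.l = Set.Icc 0 S.l := Set.uIcc_of_le S.l_pos.le

theorem intervalIntegrable_iff {E : Type*} [NormedAddCommGroup E] {g : ℝ → E} :
    IntervalIntegrable g volume 0 S.l ↔ Integrable g S.μ :=
  intervalIntegrable_iff_integrableOn_Ioo_of_le S.l_pos.le

theorem intervalIntegral_eq {E : Type*} [NormedAddCommGroup E] [NormedSpace ℝ E] (g : ℝ → E) :
    ∫ t in (0 : ℝ)..S.l, g t = ∫ t, g t ∂S.μ := by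
  rw [intervalIntegral.integral_of_le S.l_pos.le, integral_Ioc_eq_integral_Ioo]; rfl

theorem integrable_mul_continuousOn {a b : ℝ → ℂ} (ha : Integrable a S.μ)
    (hb : ContinuousOn b (Set.Icc 0 S.l)) : Integrable (fun t => a t * b t) S.μ := by
  rw [← intervalIntegrable_iff] at ha ⊢
  exact ha.mul_continuousOn (by rwa [uIcc_zero_l])

theorem mem_squareIntegrable_of_continuousOn {f : ℝ → Fin p → ℂ}
    (hf : ContinuousOn f (Set.Icc 0 S.l)) : f ∈ S.squareIntegrable := by
  refine ⟨(hf.mono Set.Ioo_subset_Icc_self).aestronglyMeasurable measurableSet_Ioo, ?_⟩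
  have hfi := continuousOn_pi.1 hf
  have e : (fun t => star (f t) ⬝ᵥ S.H t *ᵥ f t) =
      fun t => ∑ i, ∑ j, S.H t i j * (star (f t i) * f t j) := by
    ext t
    simp only [dotProduct, mulVec, Finset.mul_sum, Pi.star_apply]
    exact Finset.sum_congr rfl fun i _ => Finset.sum_congr rfl fun j _ => by ring
  rw [e]
  refine integrable_finsetSum _ fun i _ => integrable_finsetSum _ fun j _ => ?_
  exact S.integrable_mul_continuousOn (S.H_integrable i j) ((hfi i).star.mul (hfi j))

variable {S} in
theorem IsSolution.continuousOn {f g : ℝ → Fin p → ℂ} (h : S.IsSolution f g) :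
    ContinuousOn f (Set.Icc 0 S.l) := S.uIcc_zero_l ▸ h.1.continuousOn

variable {S} in
theorem IsSolution.mem_squareIntegrable {f g : ℝ → Fin p → ℂ} (h : S.IsSolution f g) :
    f ∈ S.squareIntegrable := S.mem_squareIntegrable_of_continuousOn h.continuousOn

/-- The entries of `H g` are the forms of `g` against the constant functions `e_i`, which lie in
`𝓛²_H` because `H` is integrable. -/
theorem integrable_H_mulVec (g : S.PreL2) : Integrable (fun t => S.H t *ᵥ g t) S.μ := by
  refine Integrable.of_eval fun i => ?_
  have h := S.mem_squareIntegrable_of_continuousOn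
    (f := fun _ => Pi.single i (1 : ℂ)) continuousOn_const
  simpa using S.integrable_form h.1 g.2.1 h.2 g.2.2

/-- The initial value problem `J f' + F f = z H f + H g`, `f(0) = c` is solvable. -/
theorem exists_isSolution (z : ℂ) (g : S.PreL2) (c : Fin p → ℂ) :
    ∃ f : S.PreL2, S.IsSolution f (z • f + g : S.PreL2) ∧ f 0 = c := by
  -- Since `J⁻¹ = -J`, the equation reads `f' = A f + b`; the sum of the absolute values of the
  -- entries of `A` is an integrable Lipschitz constant.
  let A : ℝ → Matrix (Fin p) (Fin p) ℂ := fun t => -(S.J * (z • S.H t - S.F t))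
  let b : ℝ → Fin p → ℂ := fun t => -(S.J *ᵥ (S.H t *ᵥ g t))
  have hA : ∀ i j, Integrable (fun t => A t i j) S.μ := by
    intro i j
    simp only [A, Matrix.neg_apply, Matrix.mul_apply, Matrix.sub_apply, Matrix.smul_apply]
    refine (integrable_finsetSum _ fun k _ => Integrable.const_mul ?_ _).neg
    exact (Integrable.const_mul (S.H_integrable k j) z).sub (S.F_integrable k j)
  have hb : Integrable b S.μ := by
    refine Integrable.neg (Integrable.of_eval fun i => ?_)
    simp only [mulVec, dotProduct]
    refine integrable_finsetSum _ fun k _ => Integrable.const_mul ?_ _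
    exact (S.integrable_H_mulVec g).eval k
  obtain ⟨f, hf, hf0, hf'⟩ := exists_absolutelyContinuousOnInterval_ae_hasDerivAt S.l_pos
    (m := fun t => ∑ i, ∑ j, ‖A t i j‖) (h := fun t v => A t *ᵥ v + b t)
    (S.intervalIntegrable_iff.2 (integrable_finsetSum _ fun i _ =>
      integrable_finsetSum _ fun j _ => (hA i j).norm))
    (fun t => by positivity)
    (fun t u v => by
      rw [add_sub_add_right_eq_sub, ← mulVec_sub]
      exact norm_mulVec_le_sum _ _)
    (fun y hy => by
      rw [intervalIntegrable_iff]
      refine Integrable.add (Integrable.of_eval fun i => ?_) hb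
      simp only [mulVec, dotProduct]
      exact integrable_finsetSum _ fun j _ =>
        S.integrable_mul_continuousOn (hA i j) (continuousOn_pi.1 hy j)) c
  have hfm : f ∈ S.squareIntegrable :=
    S.mem_squareIntegrable_of_continuousOn (S.uIcc_zero_l ▸ hf.continuousOn)
  refine ⟨⟨f, hfm⟩, ⟨hf, ?_⟩, hf0⟩
  filter_upwards [hf'] with t ht
  refine ⟨ht.differentiableAt, ?_⟩
  change S.J *ᵥ deriv f t + S.F t *ᵥ f t = S.H t *ᵥ (z • f t + g t)
  rw [ht.deriv]
  simp only [A, b, mulVec_add, mulVec_neg, neg_mulVec, ← mulVec_mulVec, J_mulVec_J_mulVec,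
    sub_mulVec, smul_mulVec, mulVec_smul]
  abel

/-- Lagrange's identity. -/
theorem lagrange {f g φ ψ : S.PreL2} (hf : S.IsSolution f g) (hφ : S.IsSolution φ ψ) {x : ℝ}
    (hx : x ∈ Set.Icc 0 S.l) :
    ∫ t in (0 : ℝ)..x, (star (φ t) ⬝ᵥ S.H t *ᵥ g t - star (ψ t) ⬝ᵥ S.H t *ᵥ f t) =
      star (φ x) ⬝ᵥ S.J *ᵥ f x - star (φ 0) ⬝ᵥ S.J *ᵥ f 0 := by
  have hsub : Set.uIcc 0 x ⊆ Set.uIcc 0 S.l :=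
    Set.uIcc_subset_uIcc_left (by rwa [uIcc_zero_l])
  have hint : Integrable (fun t => star (φ t) ⬝ᵥ S.H t *ᵥ g t - star (ψ t) ⬝ᵥ S.H t *ᵥ f t) S.μ :=
    (S.integrable_form φ.2.1 g.2.1 φ.2.2 g.2.2).sub (S.integrable_form ψ.2.1 f.2.1 ψ.2.2 f.2.2)
  refine AbsolutelyContinuousOnInterval.integral_eq_sub_of_ae_hasDerivAt
    (f := fun t => star (φ t) ⬝ᵥ S.J *ᵥ f t) hx.1
    (((hφ.1.star_dotProduct_mulVec S.J hf.1)).mono hsub)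
    ((S.intervalIntegrable_iff.2 hint).mono_set hsub) ?_
  refine ae_restrict_of_ae_restrict_of_subset (Set.Ioo_subset_Ioo_right hx.2) ?_
  filter_upwards [hf.2, hφ.2, S.F_isHermitian, S.H_posSemidef] with t ⟨d, e⟩ ⟨d', e'⟩ hF hH
  have h := d'.hasDerivAt.star_dotProduct_mulVec S.J d.hasDerivAt
  refine h.congr_deriv ?_
  have e1 : S.J *ᵥ deriv f.val t = S.H t *ᵥ g t - S.F t *ᵥ f t := eq_sub_of_add_eq e
  have e2 : S.J *ᵥ deriv φ.val t = S.H t *ᵥ ψ t - S.F t *ᵥ φ t := eq_sub_of_add_eq e'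
  -- `J` is skew-Hermitian, so it moves onto `φ'` with a sign; after substitution of both equations
  -- the `F` terms cancel because `F` is Hermitian.
  have e3 : star (deriv φ.val t) ⬝ᵥ S.J *ᵥ f t = -(star (S.J *ᵥ deriv φ.val t) ⬝ᵥ f t) := by
    rw [star_mulVec_dotProduct, S.J_conjTranspose, neg_mulVec, dotProduct_neg, neg_neg]
  rw [e1, e3, e2, star_sub, sub_dotProduct, star_mulVec_dotProduct, star_mulVec_dotProduct,
    hF.eq, hH.1.eq, dotProduct_sub]
  ring

theorem inner_cls (f g : S.PreL2) :
    inner ℂ (S.cls f) (S.cls g) = ∫ t, star (f t) ⬝ᵥ S.H t *ᵥ g t ∂S.μ := rfl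

theorem inner_cls_sub_inner_cls {f g φ ψ : S.PreL2} (hf : S.IsSolution f g)
    (hφ : S.IsSolution φ ψ) :
    inner ℂ (S.cls φ) (S.cls g) - inner ℂ (S.cls ψ) (S.cls f) =
      star (φ S.l) ⬝ᵥ S.J *ᵥ f S.l - star (φ 0) ⬝ᵥ S.J *ᵥ f 0 := by
  rw [← S.lagrange hf hφ (Set.right_mem_Icc.2 S.l_pos.le), intervalIntegral_eq, inner_cls, inner_cls,
    integral_sub (S.integrable_form φ.2.1 g.2.1 φ.2.2 g.2.2)
      (S.integrable_form ψ.2.1 f.2.1 ψ.2.2 f.2.2)]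

theorem cls_add (f g : S.PreL2) : S.cls (f + g) = S.cls f + S.cls g := rfl
theorem cls_sub (f g : S.PreL2) : S.cls (f - g) = S.cls f - S.cls g := rfl
theorem cls_smul (c : ℂ) (f : S.PreL2) : S.cls (c • f) = c • S.cls f := rfl
theorem cls_zero : S.cls 0 = 0 := rfl

theorem exists_cls_eq (x : S.L2) : ∃ f, S.cls f = x := SeparationQuotient.surjective_mk x

/-- A nonnegative function with zero integral vanishes a.e., and `f^* H f = 0` forces `H f = 0` for
positive semidefinite `H`. -/
theorem cls_eq_zero_iff {f : S.PreL2} : S.cls f = 0 ↔ ∀ᵐ t ∂S.μ, S.H t *ᵥ f t = 0 := by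
  rw [← inner_self_eq_zero (𝕜 := ℂ), inner_cls]
  constructor
  · intro h
    have h1 : ∫ t, (star (f t) ⬝ᵥ S.H t *ᵥ f t).re ∂S.μ = 0 := by
      have := integral_re f.2.2
      simp only [RCLike.re_to_complex] at this
      rw [this, h, Complex.zero_re]
    rw [integral_eq_zero_iff_of_nonneg_ae] at h1
    · filter_upwards [h1, S.H_posSemidef] with t ht hH
      rw [← hH.dotProduct_mulVec_zero_iff]
      have := Complex.le_def.1 (hH.dotProduct_mulVec_nonneg (f t))
      exact Complex.ext ht this.2.symm
    · filter_upwards [S.H_posSemidef] with t hH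
      exact (Complex.le_def.1 (hH.dotProduct_mulVec_nonneg (f t))).1
    · exact f.2.2.re
  · intro h
    refine integral_eq_zero_of_ae ?_
    filter_upwards [h] with t ht
    simp [ht]

variable {S} in
theorem IsSolution.congr_right {f : ℝ → Fin p → ℂ} {g g' : S.PreL2} (h : S.IsSolution f g)
    (hg : S.cls g = S.cls g') : S.IsSolution f g' := by
  rw [← sub_eq_zero, ← cls_sub, cls_eq_zero_iff] at hg
  refine ⟨h.1, ?_⟩
  filter_upwards [h.2, hg] with t ⟨d, e⟩ h0
  refine ⟨d, e.trans ?_⟩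
  change S.H t *ᵥ (g t - g' t) = 0 at h0
  rwa [mulVec_sub, sub_eq_zero] at h0

variable {S} in
theorem IsSolution.sub {f g f' g' : ℝ → Fin p → ℂ} (h : S.IsSolution f g)
    (h' : S.IsSolution f' g') : S.IsSolution (f - f') (g - g') := by
  have := h.add (h'.smul (-1))
  simpa only [neg_smul, one_smul, ← sub_eq_add_neg] using this

/-- A solution both of whose components represent zero vanishes. -/
theorem eq_zero_of_cls_eq_zero {f g : S.PreL2} (h : S.IsSolution f g) (hf : S.cls f = 0)
    (hg : S.cls g = 0) {t : ℝ} (ht : t ∈ Set.Icc 0 S.l) : f t = 0 := by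
  rw [cls_eq_zero_iff] at hf hg
  have h0 := S.definite f h.1 (by
    filter_upwards [h.2, hg] with t ⟨_, e⟩ h0
    rw [e, h0]) hf
  have hc : Set.Icc 0 S.l ⊆ closure (Set.Ioo 0 S.l) := by rw [closure_Ioo S.l_pos.ne]
  exact Set.EqOn.of_subset_closure (g := fun _ => 0) h0 h.continuousOn continuousOn_const
    Set.Ioo_subset_Icc_self hc ht

/-- This makes boundary values functions of a pair of classes. It uses both components; the first
alone would not suffice in general. -/
theorem eq_of_cls_eq {f g f' g' : S.PreL2} (h : S.IsSolution f g) (h' : S.IsSolution f' g')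
    (hf : S.cls f = S.cls f') (hg : S.cls g = S.cls g') {t : ℝ} (ht : t ∈ Set.Icc 0 S.l) :
    f t = f' t := by
  refine sub_eq_zero.1 (S.eq_zero_of_cls_eq_zero (f := f - f') (g := g - g') (h.sub h') ?_ ?_ ht)
  · rw [cls_sub, hf, sub_self]
  · rw [cls_sub, hg, sub_self]

/-- The pairs `(f, g)` with `J f' + F f = H g`. -/
def solutions : Submodule ℂ ((ℝ → Fin p → ℂ) × (ℝ → Fin p → ℂ)) where
  carrier := {x | S.IsSolution x.1 x.2}
  add_mem' h h' := h.add h'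
  zero_mem' := S.isSolution_zero
  smul_mem' c _ h := h.smul c

theorem exists_isFundamentalMatrix (z : ℂ) :
    ∃ U : ℝ → Matrix (Fin p) (Fin p) ℂ, S.IsFundamentalMatrix z U := by
  choose f hf hf0 using fun j : Fin p => S.exists_isSolution z 0 (Pi.single j 1)
  refine ⟨fun t => Matrix.of fun i j => f j t i, ?_, fun c => ?_⟩
  · ext i j
    simp [hf0, Matrix.one_apply, Pi.single_apply]
  · have h : ∑ j, c j • (((f j).val, z • (f j).val) : (ℝ → Fin p → ℂ) × (ℝ → Fin p → ℂ)) ∈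
        S.solutions := by
      refine Submodule.sum_mem _ fun j _ => Submodule.smul_mem _ _ ?_
      have := hf j
      rwa [add_zero] at this
    have e : (fun t => (Matrix.of fun i j => f j t i) *ᵥ c) = ∑ j, c j • (f j).val := by
      ext t i
      simp [mulVec, dotProduct, mul_comm]
    have h' : S.IsSolution (∑ j, c j • (f j).val) (∑ j, c j • z • (f j).val) := by
      simpa [solutions, Prod.fst_sum, Prod.snd_sum] using h
    have e' : (∑ j, c j • z • (f j).val) = z • ∑ j, c j • (f j).val := by
      rw [Finset.smul_sum]
      exact Finset.sum_congr rfl fun j _ => smul_comm _ _ _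
    rw [e'] at h'
    convert h' using 1
    ext1 t
    exact congrArg (z • ·) (congrFun e t)

/-- A vector solution of the homogeneous system, as an element of `𝓛²_H`. -/
def fundamentalSolution {z : ℂ} {U : ℝ → Matrix (Fin p) (Fin p) ℂ}
    (hU : S.IsFundamentalMatrix z U) (c : Fin p → ℂ) : S.PreL2 :=
  ⟨fun t => U t *ᵥ c, (hU.2 c).mem_squareIntegrable⟩

variable {S} {z : ℂ} {U W : ℝ → Matrix (Fin p) (Fin p) ℂ}

theorem IsFundamentalMatrix.isSolution (hU : S.IsFundamentalMatrix z U) (c : Fin p → ℂ) :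
    S.IsSolution (S.fundamentalSolution hU c) (z • S.fundamentalSolution hU c : S.PreL2) := hU.2 c

theorem fundamentalSolution_apply (hU : S.IsFundamentalMatrix z U) (c : Fin p → ℂ) (t : ℝ) :
    S.fundamentalSolution hU c t = U t *ᵥ c := rfl

theorem fundamentalSolution_zero (hU : S.IsFundamentalMatrix z U) (c : Fin p → ℂ) :
    S.fundamentalSolution hU c 0 = c := by
  rw [fundamentalSolution_apply, hU.1, one_mulVec]

/-- For the conjugate parameters `z` and `z̄` the integrand in Lagrange's identity is identically
zero. -/
theorem star_dotProduct_J_mulVec_eq {f φ : S.PreL2} (hf : S.IsSolution f (z • f : S.PreL2))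
    (hφ : S.IsSolution φ (conj z • φ : S.PreL2)) {x : ℝ} (hx : x ∈ Set.Icc 0 S.l) :
    star (φ x) ⬝ᵥ S.J *ᵥ f x = star (φ 0) ⬝ᵥ S.J *ᵥ f 0 := by
  rw [← sub_eq_zero, ← S.lagrange hf hφ hx]
  refine intervalIntegral.integral_zero_ae (Filter.Eventually.of_forall fun t _ => ?_)
  change _ ⬝ᵥ _ *ᵥ (z • f t) - star (conj z • φ t) ⬝ᵥ _ = 0
  rw [mulVec_smul, dotProduct_smul, star_smul, smul_dotProduct, starRingEnd_apply, star_star,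
    sub_self]

theorem IsFundamentalMatrix.conjTranspose_mul_J_mul (hU : S.IsFundamentalMatrix z U)
    (hW : S.IsFundamentalMatrix (conj z) W) {x : ℝ} (hx : x ∈ Set.Icc 0 S.l) :
    (W x)ᴴ * S.J * U x = S.J := by
  refine Matrix.ext_of_mulVec_single fun j => sub_eq_zero.1 (eq_zero_of_forall_star_dotProduct
    fun u => ?_)
  have h := star_dotProduct_J_mulVec_eq (hU.isSolution (Pi.single j 1)) (hW.isSolution u) hx
  rw [fundamentalSolution_zero, fundamentalSolution_zero, fundamentalSolution_apply,
    fundamentalSolution_apply, star_mulVec_dotProduct] at h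
  rw [dotProduct_sub, ← h, ← mulVec_mulVec, ← mulVec_mulVec, sub_self]

theorem IsFundamentalMatrix.isUnit_conjTranspose (hW : S.IsFundamentalMatrix z W) {x : ℝ}
    (hx : x ∈ Set.Icc 0 S.l) : IsUnit (W x)ᴴ := by
  obtain ⟨U, hU⟩ := S.exists_isFundamentalMatrix (conj z)
  have h := hU.conjTranspose_mul_J_mul (W := W) (by simpa using hW) hx
  refine IsUnit.of_mul_eq_one (S.J * U x * -S.J) ?_
  rw [← mul_assoc, ← mul_assoc, h, mul_neg, J_mul_J, neg_neg]

/-- Uniqueness for the initial value problem comes from the conserved form rather than from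
Gronwall's inequality: `f x` and `U x *ᵥ f 0` have the same `J`-pairing with every `W x *ᵥ u`, and
`(W x)ᴴ` is invertible. -/
theorem IsFundamentalMatrix.eq_mulVec (hU : S.IsFundamentalMatrix z U) {f : S.PreL2}
    (hf : S.IsSolution f (z • f : S.PreL2)) {x : ℝ} (hx : x ∈ Set.Icc 0 S.l) :
    f x = U x *ᵥ f 0 := by
  obtain ⟨W, hW⟩ := S.exists_isFundamentalMatrix (conj z)
  have h : (W x)ᴴ *ᵥ S.J *ᵥ (f x - U x *ᵥ f 0) = 0 := by
    refine eq_zero_of_forall_star_dotProduct fun u => ?_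
    rw [← star_mulVec_dotProduct, mulVec_sub, dotProduct_sub, sub_eq_zero]
    have h1 := star_dotProduct_J_mulVec_eq hf (hW.isSolution u) hx
    have h2 := star_dotProduct_J_mulVec_eq (hU.isSolution (f 0)) (hW.isSolution u) hx
    rw [fundamentalSolution_zero hU] at h2
    exact h1.trans h2.symm
  have h3 : S.J *ᵥ (f x - U x *ᵥ f 0) = 0 :=
    Matrix.mulVec_injective_of_isUnit (hW.isUnit_conjTranspose hx) (by rw [h, mulVec_zero])
  have h4 := S.J_mulVec_J_mulVec (f x - U x *ᵥ f 0)
  rw [h3, mulVec_zero, eq_comm, neg_eq_zero, sub_eq_zero] at h4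
  exact h4

end CanonicalSystem

/-! ### The adjoint of the minimal relation -/

namespace LinRel

variable {E : Type*} [NormedAddCommGroup E] [InnerProductSpace ℂ E]

theorem adj_topologicalClosure (T : LinRel E) : adj T.topologicalClosure = adj T := by
  refine le_antisymm (fun x hx y hy => hx y (T.le_topologicalClosure hy)) fun x hx y hy => ?_
  have hc : IsClosed {y : E × E | inner ℂ y.1 x.2 = inner ℂ y.2 x.1} :=
    isClosed_eq (by fun_prop) (by fun_prop)
  exact closure_minimal (s := (T : Set (E × E))) (fun y hy => hx y hy) hc hy

end LinRel

namespace CanonicalSystem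

variable {p : ℕ} (S : CanonicalSystem p)

theorem adj_minRel : LinRel.adj S.minRel = LinRel.adj S.preminRel :=
  LinRel.adj_topologicalClosure _

theorem maxRel_le_adj_preminRel : S.maxRel ≤ LinRel.adj S.preminRel := by
  rintro _ ⟨f, g, h, rfl⟩ _ ⟨φ, ψ, h', ⟨a, b, ha, hb, h0⟩, rfl⟩
  rw [← sub_eq_zero]
  refine (S.inner_cls_sub_inner_cls h h').trans ?_
  rw [h0 0 (Set.left_mem_Icc.2 S.l_pos.le) fun h => ha.not_ge h.1,
    h0 S.l (Set.right_mem_Icc.2 S.l_pos.le) fun h => hb.not_ge h.2]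
  simp

/-- Multiplication by the indicator function of `[a, b]`. -/
def cutoff (a b : ℝ) : S.PreL2 →ₗ[ℂ] S.PreL2 where
  toFun f := ⟨(Set.Icc a b).indicator f, by
    refine ⟨f.2.1.indicator measurableSet_Icc, ?_⟩
    refine (f.2.2.indicator (measurableSet_Icc (a := a) (b := b))).congr
      (Filter.Eventually.of_forall fun t => ?_)
    by_cases ht : t ∈ Set.Icc a b <;> simp [ht]⟩
  map_add' f g := Subtype.ext (Set.indicator_add' _ _ _)
  map_smul' c f := Subtype.ext (Set.indicator_const_smul _ c f.val)

theorem cutoff_apply (a b : ℝ) (f : S.PreL2) (t : ℝ) :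
    S.cutoff a b f t = (Set.Icc a b).indicator f.val t := rfl

theorem cls_cutoff_eq_zero_iff {a b : ℝ} {f : S.PreL2} :
    S.cls (S.cutoff a b f) = 0 ↔ ∀ᵐ t ∂S.μ, t ∈ Set.Icc a b → S.H t *ᵥ f t = 0 := by
  rw [cls_eq_zero_iff]
  refine Filter.eventually_congr (Filter.Eventually.of_forall fun t => ?_)
  by_cases ht : t ∈ Set.Icc a b <;> simp [cutoff_apply, ht]

theorem inner_cls_cutoff_left (a b : ℝ) (f g : S.PreL2) :
    inner ℂ (S.cls (S.cutoff a b f)) (S.cls g) =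
      inner ℂ (S.cls (S.cutoff a b f)) (S.cls (S.cutoff a b g)) := by
  rw [inner_cls, inner_cls]
  refine integral_congr_ae (Filter.Eventually.of_forall fun t => ?_)
  by_cases ht : t ∈ Set.Icc a b <;> simp [cutoff_apply, ht]

variable {S} {z : ℂ} {U W : ℝ → Matrix (Fin p) (Fin p) ℂ}

theorem IsFundamentalMatrix.eq_zero_of_forall (hU : S.IsFundamentalMatrix z U) {x : ℝ}
    (hx : x ∈ Set.Icc 0 S.l) {v : Fin p → ℂ}
    (h : ∀ u, star (U x *ᵥ u) ⬝ᵥ S.J *ᵥ v = 0) : v = 0 := by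
  have h3 : S.J *ᵥ v = 0 :=
    Matrix.mulVec_injective_of_isUnit (hU.isUnit_conjTranspose hx) (by
      refine (eq_zero_of_forall_star_dotProduct fun u => ?_).trans (mulVec_zero _).symm
      rw [← star_mulVec_dotProduct, h])
  have h4 := S.J_mulVec_J_mulVec v
  rwa [h3, mulVec_zero, eq_comm, neg_eq_zero] at h4

/-- `c ↦ U(·) c` as a linear map into `𝓛²_H`. -/
def IsFundamentalMatrix.solutionMap (hU : S.IsFundamentalMatrix z U) :
    (Fin p → ℂ) →ₗ[ℂ] S.PreL2 where
  toFun c := S.fundamentalSolution hU c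
  map_add' c d := Subtype.ext (funext fun t => mulVec_add (U t) c d)
  map_smul' a c := Subtype.ext (funext fun t => mulVec_smul (U t) a c)

theorem IsFundamentalMatrix.eq_zero_of_cls_eq_zero (hU : S.IsFundamentalMatrix z U)
    {c : Fin p → ℂ} (h : S.cls (S.fundamentalSolution hU c) = 0) : c = 0 := by
  rw [← fundamentalSolution_zero hU c]
  exact S.eq_zero_of_cls_eq_zero (hU.isSolution c) h (by rw [cls_smul, h, smul_zero])
    (Set.left_mem_Icc.2 S.l_pos.le)

theorem IsFundamentalMatrix.isSolution_zero_right (hU : S.IsFundamentalMatrix 0 U)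
    (c : Fin p → ℂ) : S.IsSolution (S.fundamentalSolution hU c) (0 : S.PreL2) := by
  have := hU.isSolution c
  rwa [zero_smul] at this

/-- A function supported in `[a, b]` and orthogonal to the solutions of the homogeneous equation
is the right-hand side of a solution supported in `[a, b]`. -/
theorem IsFundamentalMatrix.exists_isSolution_cutoff (hU : S.IsFundamentalMatrix 0 U) {a b : ℝ} (k : S.PreL2)
    (hk : ∀ d, inner ℂ (S.cls (S.fundamentalSolution hU d)) (S.cls (S.cutoff a b k)) = 0) :
    ∃ φ : S.PreL2, S.IsSolution φ (S.cutoff a b k) ∧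
      ∀ t ∈ Set.Icc 0 S.l, t ∉ Set.Icc a b → φ t = 0 := by
  obtain ⟨φ, hφ, hφ0⟩ := S.exists_isSolution 0 (S.cutoff a b k) 0
  rw [zero_smul, zero_add] at hφ
  refine ⟨φ, hφ, fun t ht hab => hU.eq_zero_of_forall ht fun d => ?_⟩
  -- As `φ 0 = 0`, this writes the pairing of `φ t` with a homogeneous solution as an integral over
  -- `[0, t]` of a function vanishing off `[a, b]`. It is zero if `t < a`; if `t > b` it is the full
  -- inner product in `hk`.
  have h := S.lagrange hφ (hU.isSolution_zero_right d) ht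
  rw [hφ0, mulVec_zero, dotProduct_zero, sub_zero] at h
  refine h.symm.trans ?_
  have h0 : ∀ s, s ∉ Set.Icc a b → star (S.fundamentalSolution hU d s) ⬝ᵥ
      S.H s *ᵥ (S.cutoff a b k) s - star ((0 : S.PreL2) s) ⬝ᵥ S.H s *ᵥ φ s = 0 := by
    intro s hs
    have e : (0 : S.PreL2) s = 0 := rfl
    rw [cutoff_apply, Set.indicator_of_notMem hs, e]
    simp
  by_cases hta : t < a
  · refine intervalIntegral.integral_zero_ae (Filter.Eventually.of_forall fun s hs => h0 s ?_)
    rw [Set.uIoc_of_le ht.1] at hs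
    exact fun h => absurd h.1 (by linarith [hs.2])
  · have htb : b < t := by
      by_contra hcon
      exact hab ⟨not_lt.1 hta, not_lt.1 hcon⟩
    set F : ℝ → ℂ := fun s => star (S.fundamentalSolution hU d s) ⬝ᵥ
      S.H s *ᵥ (S.cutoff a b k) s - star ((0 : S.PreL2) s) ⬝ᵥ S.H s *ᵥ φ s with hF
    have hFi : IntervalIntegrable F volume 0 S.l := S.intervalIntegrable_iff.2
      ((S.integrable_form (S.fundamentalSolution hU d).2.1 (S.cutoff a b k).2.1
        (S.fundamentalSolution hU d).2.2 (S.cutoff a b k).2.2).sub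
        (S.integrable_form (0 : S.PreL2).2.1 φ.2.1 (0 : S.PreL2).2.2 φ.2.2))
    have htU : t ∈ Set.uIcc 0 S.l := by rwa [S.uIcc_zero_l]
    have h1 := intervalIntegral.integral_add_adjacent_intervals
      (hFi.mono_set (Set.uIcc_subset_uIcc_left htU)) (hFi.mono_set (Set.uIcc_subset_uIcc_right htU))
    have h2 : ∫ s in t..S.l, F s = 0 := by
      refine intervalIntegral.integral_zero_ae (Filter.Eventually.of_forall fun s hs => h0 s ?_)
      rw [Set.uIoc_of_le ht.2] at hs
      exact fun h => absurd h.2 (by linarith [hs.1])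
    rw [h2, add_zero] at h1
    rw [h1, S.intervalIntegral_eq, ← hk d, inner_cls]
    refine integral_congr_ae (Filter.Eventually.of_forall fun s => ?_)
    have e : (0 : S.PreL2) s = 0 := rfl
    simp only [hF, e]
    simp

/-- Orthogonal projection onto the range of `T`, which is finite-dimensional and hence complete, so
completeness of `E` is not needed. -/
theorem exists_forall_inner_sub_eq_zero {V E : Type*} [AddCommGroup V] [Module ℂ V]
    [FiniteDimensional ℂ V] [NormedAddCommGroup E] [InnerProductSpace ℂ E] (T : V →ₗ[ℂ] E)
    (x : E) : ∃ c, ∀ d, inner ℂ (T d) (x - T c) = 0 := by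
  have : CompleteSpace (LinearMap.range T) := FiniteDimensional.complete ℂ _
  obtain ⟨c, hc⟩ := ((LinearMap.range T).orthogonalProjectionOnto x).2
  refine ⟨c, fun d => ?_⟩
  rw [hc]
  exact (LinearMap.range T).sub_starProjection_mem_orthogonal x _ ⟨d, rfl⟩

/-- On every compact subinterval, a pair in the adjoint of the preminimal relation agrees with an
absolutely continuous solution. -/
theorem IsFundamentalMatrix.exists_ae_eq_of_mem_adj (hU : S.IsFundamentalMatrix 0 U) {a b : ℝ}
    (ha : 0 < a) (hb : b < S.l) {f g h : S.PreL2} (hh : S.IsSolution h g)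
    (hfg : (S.cls f, S.cls g) ∈ LinRel.adj S.preminRel) :
    ∃ c, S.cls (S.cutoff a b (f - h - S.fundamentalSolution hU c)) = 0 := by
  let cl : S.PreL2 →ₗ[ℂ] S.L2 :=
    { toFun := S.cls, map_add' := fun _ _ => rfl, map_smul' := fun _ _ => rfl }
  obtain ⟨c, hc⟩ := exists_forall_inner_sub_eq_zero
    (cl ∘ₗ S.cutoff a b ∘ₗ hU.solutionMap) (S.cls (S.cutoff a b (f - h)))
  set k := f - h - S.fundamentalSolution hU c with hk
  have hc' : ∀ d, inner ℂ (S.cls (S.cutoff a b (S.fundamentalSolution hU d)))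
      (S.cls (S.cutoff a b k)) = 0 := by
    intro d
    rw [hk, map_sub, cls_sub]
    exact hc d
  have hc'' : ∀ d, inner ℂ (S.cls (S.cutoff a b k)) (S.cls (S.fundamentalSolution hU d)) = 0 := by
    intro d
    rw [inner_cls_cutoff_left, ← inner_conj_symm, hc' d, map_zero]
  refine ⟨c, ?_⟩
  obtain ⟨φ, hφ, hφ0⟩ := hU.exists_isSolution_cutoff k fun d => by
    rw [← inner_conj_symm, hc'' d, map_zero]
  -- The adjoint relation for `f` and Lagrange's identity for `h`, both tested against `φ`, show
  -- that the cut-off `k` is orthogonal to `f - h`. It is also orthogonal to the homogeneous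
  -- solutions, hence to `k` itself.
  have h1 : inner ℂ (S.cls φ) (S.cls g) = inner ℂ (S.cls (S.cutoff a b k)) (S.cls f) :=
    hfg (S.cls φ, S.cls (S.cutoff a b k)) ⟨φ, _, hφ, ⟨a, b, ha, hb, hφ0⟩, rfl⟩
  have h2 := S.inner_cls_sub_inner_cls hh hφ
  rw [hφ0 0 (Set.left_mem_Icc.2 S.l_pos.le) fun h => ha.not_ge h.1,
    hφ0 S.l (Set.right_mem_Icc.2 S.l_pos.le) fun h => hb.not_ge h.2, h1] at h2
  simp only [star_zero, zero_dotProduct, sub_zero] at h2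
  rw [← inner_self_eq_zero (𝕜 := ℂ), ← inner_cls_cutoff_left,
    show S.cls k = S.cls f - S.cls h - S.cls (S.fundamentalSolution hU c) from rfl,
    inner_sub_right, inner_sub_right, h2, hc'', sub_zero]

/-- On each interval of an exhaustion, `f - h` is a homogeneous solution `U c`, with `c` unique up
to a subspace that shrinks as the interval grows. By finite dimension these subspaces stabilize, and
by definiteness their final value is zero, so one constant serves on all of `(0, l)`. -/
theorem adj_preminRel_le_maxRel : LinRel.adj S.preminRel ≤ S.maxRel := by
  rintro ⟨u, w⟩ hx
  obtain ⟨f, rfl⟩ := S.exists_cls_eq u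
  obtain ⟨g, rfl⟩ := S.exists_cls_eq w
  obtain ⟨U, hU⟩ := S.exists_isFundamentalMatrix 0
  obtain ⟨h, hh, -⟩ := S.exists_isSolution 0 g 0
  rw [zero_smul, zero_add] at hh
  -- The intervals `[a n, l - a n]` increase to `(0, l)`; the one with `n = 0` is empty, which is
  -- harmless.
  let a : ℕ → ℝ := fun n => S.l / (n + 1)
  have ha : ∀ n, 0 < a n := fun n => div_pos S.l_pos (by positivity)
  have hanti : ∀ m n, m ≤ n → a n ≤ a m := fun m n hmn =>
    div_le_div_of_nonneg_left S.l_pos.le (by positivity) (by gcongr)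
  have hIcc : ∀ m n, m ≤ n → Set.Icc (a m) (S.l - a m) ⊆ Set.Icc (a n) (S.l - a n) :=
    fun m n hmn => Set.Icc_subset_Icc (hanti m n hmn) (by linarith [hanti m n hmn])
  have hexh : ∀ t ∈ Set.Ioo 0 S.l, ∃ N, ∀ n ≥ N, t ∈ Set.Icc (a n) (S.l - a n) := by
    intro t ht
    have hlim : Filter.Tendsto a Filter.atTop (nhds 0) :=
      tendsto_const_div_atTop_nhds_zero_nat S.l |>.comp (Filter.tendsto_add_atTop_nat 1) |>.congr
        fun n => by simp [a]
    have h1 := hlim.eventually (gt_mem_nhds ht.1)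
    have h2 := hlim.eventually (gt_mem_nhds (sub_pos.2 ht.2))
    obtain ⟨N, hN⟩ := Filter.eventually_atTop.1 (h1.and h2)
    exact ⟨N, fun n hn => ⟨(hN n hn).1.le, by linarith [(hN n hn).2]⟩⟩
  -- `N n` is the ambiguity of the constant on the `n`-th interval. The order dual turns this
  -- decreasing sequence into a monotone one, as the Artinian condition expects.
  let N : ℕ →o (Submodule ℂ (Fin p → ℂ))ᵒᵈ :=
    { toFun := fun n => OrderDual.toDual
        { carrier := {c | S.cls (S.cutoff (a n) (S.l - a n) (S.fundamentalSolution hU c)) = 0}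
          add_mem' := fun {c d} hc hd => by
            change S.cls (S.cutoff _ _ (hU.solutionMap (c + d))) = 0
            rw [map_add, map_add, cls_add]
            change S.cls _ = 0 at hc hd
            exact (congrArg₂ (· + ·) hc hd).trans (add_zero 0)
          zero_mem' := by
            change S.cls (S.cutoff _ _ (hU.solutionMap 0)) = 0
            rw [map_zero, map_zero, cls_zero]
          smul_mem' := fun r c hc => by
            change S.cls (S.cutoff _ _ (hU.solutionMap (r • c))) = 0
            rw [map_smul, map_smul, cls_smul]
            change S.cls _ = 0 at hc
            exact (congrArg (r • ·) hc).trans (smul_zero r) }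
      monotone' := fun m n hmn c hc => by
        refine S.cls_cutoff_eq_zero_iff.2 ?_
        filter_upwards [S.cls_cutoff_eq_zero_iff.1 hc] with t ht h1 using ht (hIcc m n hmn h1) }
  have hN : ∀ n c, c ∈ OrderDual.ofDual (N n) ↔
      S.cls (S.cutoff (a n) (S.l - a n) (S.fundamentalSolution hU c)) = 0 := fun _ _ => Iff.rfl
  have hae : ∀ (n₀ : ℕ) (k : S.PreL2), (∀ n ≥ n₀, S.cls (S.cutoff (a n) (S.l - a n) k) = 0) →
      S.cls k = 0 := by
    intro n₀ k hk
    rw [cls_eq_zero_iff]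
    have h1 : ∀ᵐ t ∂S.μ, ∀ n ≥ n₀, t ∈ Set.Icc (a n) (S.l - a n) → S.H t *ᵥ k t = 0 :=
      ae_all_iff.2 fun n => by
        by_cases hn : n ≥ n₀
        · filter_upwards [S.cls_cutoff_eq_zero_iff.1 (hk n hn)] with t ht _ using ht
        · exact Filter.Eventually.of_forall fun t h => absurd h hn
    filter_upwards [h1, ae_restrict_mem measurableSet_Ioo] with t h2 h3
    obtain ⟨M, hM⟩ := hexh t h3
    exact h2 (max n₀ M) (le_max_left _ _) (hM _ (le_max_right _ _))
  obtain ⟨n₀, hn₀⟩ := IsArtinian.monotone_stabilizes N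
  have hbot : ∀ c, c ∈ OrderDual.ofDual (N n₀) → c = 0 := by
    intro c hc
    refine hU.eq_zero_of_cls_eq_zero (hae n₀ _ fun n hn => ?_)
    rw [← hN, ← hn₀ n hn]
    exact hc
  choose c hc using fun n => hU.exists_ae_eq_of_mem_adj (ha n)
    (show S.l - a n < S.l by linarith [ha n]) hh hx
  have hcc : ∀ n ≥ n₀, c n = c n₀ := by
    intro n hn
    refine sub_eq_zero.1 (hbot _ ((hN _ _).2 (S.cls_cutoff_eq_zero_iff.2 ?_)))
    filter_upwards [S.cls_cutoff_eq_zero_iff.1 (hc n), S.cls_cutoff_eq_zero_iff.1 (hc n₀)] with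
      t h1 h2 ht
    have h3 := h1 (hIcc _ _ hn ht)
    have h4 := h2 ht
    change S.H t *ᵥ (f t - h t - U t *ᵥ c n) = 0 at h3
    change S.H t *ᵥ (f t - h t - U t *ᵥ c n₀) = 0 at h4
    change S.H t *ᵥ (U t *ᵥ (c n - c n₀)) = 0
    have : U t *ᵥ (c n - c n₀) = (f t - h t - U t *ᵥ c n₀) - (f t - h t - U t *ᵥ c n) := by
      rw [mulVec_sub]; abel
    rw [this, mulVec_sub, h3, h4, sub_zero]
  have hfin : S.cls (f - h - S.fundamentalSolution hU (c n₀)) = 0 :=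
    hae n₀ _ fun n hn => by
      have := hc n
      rwa [hcc n hn] at this
  refine ⟨h + S.fundamentalSolution hU (c n₀), g, ?_, ?_⟩
  · have := hh.add (hU.isSolution_zero_right (c n₀))
    rwa [show g.val + (0 : S.PreL2).val = g.val from add_zero _] at this
  · rw [sub_sub, cls_sub, sub_eq_zero] at hfin
    rw [hfin]

variable (S) in
theorem maxRel_eq_adj_minRel : S.maxRel = LinRel.adj S.minRel := by
  rw [adj_minRel]
  exact le_antisymm S.maxRel_le_adj_preminRel adj_preminRel_le_maxRel

end CanonicalSystem

/-! ### Boundary values, the boundary triple and the operator `L` -/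

namespace CanonicalSystem

variable {p : ℕ} {S : CanonicalSystem p}

theorem mem_adj_minRel_iff {x : S.L2 × S.L2} :
    x ∈ LinRel.adj S.minRel ↔ ∃ f g : S.PreL2, S.IsSolution f g ∧ x = (S.cls f, S.cls g) := by
  rw [← maxRel_eq_adj_minRel]; rfl

theorem IsSolution.mem_adj {f g : S.PreL2} (h : S.IsSolution f g) :
    (S.cls f, S.cls g) ∈ LinRel.adj S.minRel := mem_adj_minRel_iff.2 ⟨f, g, h, rfl⟩

theorem IsSolution.mem_dom {f g : S.PreL2} (h : S.IsSolution f g) :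
    S.cls f ∈ LinRel.dom (LinRel.adj S.minRel) := ⟨_, h.mem_adj, rfl⟩

theorem exists_isSolution_of_mem_dom {x : S.L2} (h : x ∈ LinRel.dom (LinRel.adj S.minRel)) :
    ∃ f g : S.PreL2, S.IsSolution f g ∧ x = S.cls f := by
  obtain ⟨y, hy, rfl⟩ := h
  obtain ⟨f, g, h, rfl⟩ := mem_adj_minRel_iff.1 hy
  exact ⟨f, g, h, rfl⟩

theorem zero_mem_Icc (S : CanonicalSystem p) : (0 : ℝ) ∈ Set.Icc 0 S.l :=
  Set.left_mem_Icc.2 S.l_pos.le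

theorem l_mem_Icc (S : CanonicalSystem p) : S.l ∈ Set.Icc 0 S.l :=
  Set.right_mem_Icc.2 S.l_pos.le

variable (S) in
/-- Every pair of boundary values is attained in the maximal relation. -/
theorem exists_isSolution_boundary (u v : Fin p → ℂ) :
    ∃ f g : S.PreL2, S.IsSolution f g ∧ f 0 = u ∧ f S.l = v := by
  obtain ⟨U, hU⟩ := S.exists_isFundamentalMatrix 0
  let y : (Fin p → ℂ) →ₗ[ℂ] S.L2 :=
    { toFun := fun d => S.cls (hU.solutionMap d)
      map_add' := fun c d => by rw [map_add, cls_add]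
      map_smul' := fun c d => by rw [map_smul, cls_smul]; rfl }
  let G : (Fin p → ℂ) →ₗ[ℂ] (Fin p → ℂ) :=
    { toFun := fun d i => inner ℂ (y (Pi.single i 1)) (y d)
      map_add' := fun c d => by ext i; simp [inner_add_right]
      map_smul' := fun c d => by ext i; simp [inner_smul_right] }
  have hG : ∀ c d, inner ℂ (y c) (y d) = star c ⬝ᵥ G d := by
    intro c d
    have hc : c = ∑ i, c i • (Pi.single i 1 : Fin p → ℂ) := by
      ext j; simp [Pi.single_apply]
    conv_lhs => rw [hc]
    rw [map_sum, sum_inner]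
    refine Finset.sum_congr rfl fun i _ => ?_
    rw [map_smul, inner_smul_left]; rfl
  have hinj : Function.Injective G := by
    rw [← LinearMap.ker_eq_bot, LinearMap.ker_eq_bot']
    intro d hd
    refine hU.eq_zero_of_cls_eq_zero ?_
    have h := hG d d
    rw [hd, dotProduct_zero, inner_self_eq_zero] at h
    exact h
  -- The right-hand side of `f` is sought as a homogeneous solution `U d`. Lagrange's identity
  -- against all `U c` gives `G d = U(l)^* J f(l) - J u`, so this `d` enforces `f(l) = v`.
  obtain ⟨d, hd⟩ := LinearMap.injective_iff_surjective.1 hinj ((U S.l)ᴴ *ᵥ S.J *ᵥ v - S.J *ᵥ u)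
  obtain ⟨f, hf, hf0⟩ := S.exists_isSolution 0 (S.fundamentalSolution hU d) u
  rw [zero_smul, zero_add] at hf
  refine ⟨f, _, hf, hf0, sub_eq_zero.1 (hU.eq_zero_of_forall S.l_mem_Icc fun c => ?_)⟩
  have h := S.inner_cls_sub_inner_cls hf (hU.isSolution_zero_right c)
  rw [cls_zero, inner_zero_left, sub_zero, fundamentalSolution_zero hU, hf0] at h
  have h' : star c ⬝ᵥ G d = star (U S.l *ᵥ c) ⬝ᵥ S.J *ᵥ f S.l - star c ⬝ᵥ S.J *ᵥ u :=
    (hG c d).symm.trans h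
  rw [hd, dotProduct_sub, ← star_mulVec_dotProduct, sub_left_inj] at h'
  rw [mulVec_sub, dotProduct_sub, h', sub_self]

section Triple

/-- The value at `t` of the absolutely continuous representative of an element of `A^*`. -/
def evalAdj (t : ℝ) (x : LinRel.adj S.minRel) : Fin p → ℂ :=
  (mem_adj_minRel_iff.1 x.2).choose t

theorem evalAdj_eq {t : ℝ} (ht : t ∈ Set.Icc 0 S.l) {f g : S.PreL2} (h : S.IsSolution f g)
    {x : LinRel.adj S.minRel} (hx : x.1 = (S.cls f, S.cls g)) : S.evalAdj t x = f t := by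
  obtain ⟨g', h', e⟩ := (mem_adj_minRel_iff.1 x.2).choose_spec
  have e' := e.symm.trans hx
  exact S.eq_of_cls_eq h' h (congrArg Prod.fst e') (congrArg Prod.snd e') ht

variable (S) in
/-- `evalAdj` as a linear map. -/
def evalAdjₗ (t : Set.Icc 0 S.l) : LinRel.adj S.minRel →ₗ[ℂ] (Fin p → ℂ) where
  toFun := S.evalAdj t
  map_add' x y := by
    obtain ⟨f, g, h, e⟩ := mem_adj_minRel_iff.1 x.2
    obtain ⟨f', g', h', e'⟩ := mem_adj_minRel_iff.1 y.2
    rw [evalAdj_eq t.2 h e, evalAdj_eq t.2 h' e',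
      evalAdj_eq (f := f + f') (g := g + g') t.2 (h.add h')]
    · rfl
    · rw [Submodule.coe_add, e, e']; rfl
  map_smul' c x := by
    obtain ⟨f, g, h, e⟩ := mem_adj_minRel_iff.1 x.2
    rw [evalAdj_eq t.2 h e, evalAdj_eq (f := c • f) (g := c • g) t.2 (h.smul c)]
    · rfl
    · rw [Submodule.coe_smul, e]; rfl

theorem sqrt_two_mul_self : (Real.sqrt 2 : ℂ) * (Real.sqrt 2 : ℂ) = 2 := by
  rw [← Complex.ofReal_mul, Real.mul_self_sqrt (by norm_num)]; norm_num

theorem sqrt_two_ne_zero : (Real.sqrt 2 : ℂ) ≠ 0 := by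
  intro h
  have := sqrt_two_mul_self
  rw [h] at this
  norm_num at this

theorem star_sqrt_two : star (Real.sqrt 2 : ℂ) = Real.sqrt 2 := Complex.conj_ofReal _

theorem one_div_sqrt_two_mul_self :
    (1 / (Real.sqrt 2 : ℂ)) * (1 / (Real.sqrt 2 : ℂ)) = 1 / 2 := by
  rw [div_mul_div_comm, sqrt_two_mul_self, one_mul]

theorem star_one_div_sqrt_two : star (1 / (Real.sqrt 2 : ℂ)) = 1 / (Real.sqrt 2 : ℂ) := by
  rw [star_div₀, star_one, star_sqrt_two]

/-- On expansion the mixed terms in the values at `0` and `l` cancel, and each diagonal term occurs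
twice with weight `1/2`. -/
theorem green_boundary (J : Matrix (Fin p) (Fin p) ℂ) (hJ : Jᴴ = -J) (f0 fl g0 gl : Fin p → ℂ) :
    star gl ⬝ᵥ J *ᵥ fl - star g0 ⬝ᵥ J *ᵥ f0 =
      star ((1 / (Real.sqrt 2 : ℂ)) • (g0 + gl)) ⬝ᵥ -((1 / (Real.sqrt 2 : ℂ)) • J *ᵥ (f0 - fl)) -
      star (-((1 / (Real.sqrt 2 : ℂ)) • J *ᵥ (g0 - gl))) ⬝ᵥ
        ((1 / (Real.sqrt 2 : ℂ)) • (f0 + fl)) := by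
  simp only [star_neg, star_smul, star_one_div_sqrt_two, dotProduct_neg, neg_dotProduct,
    smul_dotProduct, dotProduct_smul, smul_eq_mul, star_mulVec_dotProduct, hJ, neg_mulVec]
  simp only [mulVec_sub, mulVec_add, star_add, star_sub, add_dotProduct, sub_dotProduct,
    dotProduct_add, dotProduct_sub]
  linear_combination (-2 * (star gl ⬝ᵥ J *ᵥ fl - star g0 ⬝ᵥ J *ᵥ f0)) *
    one_div_sqrt_two_mul_self

variable (S) in
/-- The boundary triple of the canonical system. -/
def canonicalTriple : LinRel.BoundaryTriple S.minRel p where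
  Γ₀ := (1 / (Real.sqrt 2 : ℂ)) • (S.evalAdjₗ ⟨0, S.zero_mem_Icc⟩ + S.evalAdjₗ ⟨S.l, S.l_mem_Icc⟩)
  Γ₁ := -((1 / (Real.sqrt 2 : ℂ)) • (Matrix.mulVecLin S.J ∘ₗ
    (S.evalAdjₗ ⟨0, S.zero_mem_Icc⟩ - S.evalAdjₗ ⟨S.l, S.l_mem_Icc⟩)))
  green x y := by
    obtain ⟨f, g, h, e⟩ := mem_adj_minRel_iff.1 x.2
    obtain ⟨f', g', h', e'⟩ := mem_adj_minRel_iff.1 y.2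
    have a0 : S.evalAdjₗ ⟨0, S.zero_mem_Icc⟩ x = f 0 := evalAdj_eq S.zero_mem_Icc h e
    have a1 : S.evalAdjₗ ⟨S.l, S.l_mem_Icc⟩ x = f S.l := evalAdj_eq S.l_mem_Icc h e
    have b0 : S.evalAdjₗ ⟨0, S.zero_mem_Icc⟩ y = f' 0 := evalAdj_eq S.zero_mem_Icc h' e'
    have b1 : S.evalAdjₗ ⟨S.l, S.l_mem_Icc⟩ y = f' S.l := evalAdj_eq S.l_mem_Icc h' e'
    rw [e, e']
    refine (S.inner_cls_sub_inner_cls h h').trans ?_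
    simp only [LinearMap.smul_apply, LinearMap.add_apply, LinearMap.neg_apply, LinearMap.comp_apply,
      LinearMap.sub_apply, mulVecLin_apply, a0, a1, b0, b1]
    exact green_boundary S.J S.J_conjTranspose _ _ _ _
  surjective u v := by
    -- Solution of `f(0) + f(l) = √2 u` and `f(0) - f(l) = √2 J v`; the second gives `Γ₁ = v`
    -- because `J² = -1`.
    obtain ⟨f, g, h, h0, h1⟩ := S.exists_isSolution_boundary
      (((Real.sqrt 2 : ℂ) / 2) • (u + S.J *ᵥ v)) (((Real.sqrt 2 : ℂ) / 2) • (u - S.J *ᵥ v))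
    refine ⟨⟨_, h.mem_adj⟩, ?_, ?_⟩
    · change (1 / (Real.sqrt 2 : ℂ)) • (S.evalAdj _ _ + S.evalAdj _ _) = u
      rw [evalAdj_eq S.zero_mem_Icc h rfl, evalAdj_eq S.l_mem_Icc h rfl, h0, h1, ← smul_add,
        add_add_sub_cancel, ← two_smul ℂ u, smul_smul, smul_smul]
      have := sqrt_two_ne_zero
      convert one_smul ℂ u using 2
      field_simp
    · change -((1 / (Real.sqrt 2 : ℂ)) • S.J *ᵥ (S.evalAdj _ _ - S.evalAdj _ _)) = v
      rw [evalAdj_eq S.zero_mem_Icc h rfl, evalAdj_eq S.l_mem_Icc h rfl, h0, h1, ← smul_sub,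
        add_sub_sub_cancel, ← two_smul ℂ (S.J *ᵥ v), mulVec_smul, mulVec_smul, J_mulVec_J_mulVec,
        smul_neg, smul_neg, smul_neg, neg_neg, smul_smul, smul_smul]
      have := sqrt_two_ne_zero
      convert one_smul ℂ v using 2
      field_simp

variable (S) in
theorem isCanonicalTriple_canonicalTriple : S.IsCanonicalTriple S.canonicalTriple := by
  intro f g h hm
  have a0 : S.evalAdj 0 ⟨(S.cls f, S.cls g), hm⟩ = f 0 := evalAdj_eq S.zero_mem_Icc h rfl
  have a1 : S.evalAdj S.l ⟨(S.cls f, S.cls g), hm⟩ = f S.l := evalAdj_eq S.l_mem_Icc h rfl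
  rw [← a0, ← a1]
  exact ⟨rfl, rfl⟩

variable (S) in
theorem existsUnique_isCanonicalTriple :
    ∃! B : LinRel.BoundaryTriple S.minRel p, S.IsCanonicalTriple B := by
  refine ⟨S.canonicalTriple, S.isCanonicalTriple_canonicalTriple, fun B hB => ?_⟩
  have key : ∀ x, B.Γ₀ x = S.canonicalTriple.Γ₀ x ∧ B.Γ₁ x = S.canonicalTriple.Γ₁ x := by
    rintro ⟨x, hx⟩
    obtain ⟨f, g, h, rfl⟩ := mem_adj_minRel_iff.1 hx
    have h1 := hB f g h hx
    have h2 := S.isCanonicalTriple_canonicalTriple f g h hx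
    exact ⟨h1.1.trans h2.1.symm, h1.2.trans h2.2.symm⟩
  have e0 : B.Γ₀ = S.canonicalTriple.Γ₀ := LinearMap.ext fun x => (key x).1
  have e1 : B.Γ₁ = S.canonicalTriple.Γ₁ := LinearMap.ext fun x => (key x).2
  cases B
  cases hC : S.canonicalTriple
  rw [hC] at e0 e1
  simp only at e0 e1
  subst e0 e1
  rfl

end Triple

section Gauge

variable (S) in
/-- Boundary values are bounded with respect to the graph norm. -/
theorem exists_norm_apply_zero_le : ∃ C : ℝ, 0 ≤ C ∧ ∀ f g : S.PreL2, S.IsSolution f g →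
    ‖f 0‖ ≤ C * (‖S.cls f‖ + ‖S.cls g‖) := by
  -- With `φ i (0) = J e_i` and `φ i (l) = 0`, the boundary term in Lagrange's identity is minus the
  -- `i`-th coordinate of `f 0`, since `J^* J = 1`.
  choose φ ψ h h0 h1 using fun i : Fin p =>
    S.exists_isSolution_boundary (S.J *ᵥ Pi.single i 1) 0
  refine ⟨∑ i, (‖S.cls (φ i)‖ + ‖S.cls (ψ i)‖), by positivity, fun f g hf => ?_⟩
  refine (pi_norm_le_iff_of_nonneg (by positivity)).2 fun i => ?_
  have e := S.inner_cls_sub_inner_cls hf (h i)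
  rw [h0, h1, star_zero, zero_dotProduct, zero_sub, star_mulVec_dotProduct, mulVec_mulVec,
    S.J_unitary, one_mulVec] at e
  have e' : star (Pi.single i 1) ⬝ᵥ f 0 = f 0 i := by simp
  rw [e'] at e
  calc ‖f 0 i‖ = ‖inner ℂ (S.cls (φ i)) (S.cls g) - inner ℂ (S.cls (ψ i)) (S.cls f)‖ := by
        rw [e, norm_neg]
    _ ≤ ‖S.cls (φ i)‖ * ‖S.cls g‖ + ‖S.cls (ψ i)‖ * ‖S.cls f‖ :=
        (norm_sub_le _ _).trans (add_le_add (norm_inner_le_norm _ _) (norm_inner_le_norm _ _))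
    _ ≤ (‖S.cls (φ i)‖ + ‖S.cls (ψ i)‖) * (‖S.cls f‖ + ‖S.cls g‖) := by
        nlinarith [mul_nonneg (norm_nonneg (S.cls (φ i))) (norm_nonneg (S.cls f)),
          mul_nonneg (norm_nonneg (S.cls (ψ i))) (norm_nonneg (S.cls g))]
    _ ≤ _ := mul_le_mul_of_nonneg_right (Finset.single_le_sum
        (f := fun i => ‖S.cls (φ i)‖ + ‖S.cls (ψ i)‖) (fun i _ => by positivity)
        (Finset.mem_univ i)) (by positivity)

theorem eval_zero_eq (hδ : S.EvalWellDefined) {f g f' g' : S.PreL2} (h : S.IsSolution f g)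
    (h' : S.IsSolution f' g') (e : S.cls f = S.cls f') : f 0 = f' 0 := by
  refine sub_eq_zero.1 (hδ (f - f') (g - g') (h.sub h') ?_)
  rw [cls_sub, e, sub_self]

/-- The value `f(0)` of `f ∈ H₊`. -/
def evalZero (f : LinRel.HPlus S.minRel) : Fin p → ℂ :=
  (exists_isSolution_of_mem_dom f.2).choose 0

theorem evalZero_eq (hδ : S.EvalWellDefined) {f g : S.PreL2} (h : S.IsSolution f g)
    {x : LinRel.HPlus S.minRel} (hx : (x : S.L2) = S.cls f) : S.evalZero x = f 0 := by
  obtain ⟨g', h', e⟩ := (exists_isSolution_of_mem_dom x.2).choose_spec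
  exact S.eval_zero_eq hδ h' h (e.symm.trans hx)

/-- This freedom in the second component accounts for the projection `P₀` in the norm of `H₊`. -/
theorem sub_mem_adj_of_mem_orthogonal {E : Type*} [NormedAddCommGroup E] [InnerProductSpace ℂ E]
    {A : LinRel E} {x y m : E} (h : (x, y) ∈ LinRel.adj A) (hm : m ∈ (LinRel.dom A)ᗮ) :
    (x, y - m) ∈ LinRel.adj A := by
  intro w hw
  have := hm w.1 ⟨w, hw, rfl⟩
  change inner ℂ w.1 (y - m) = inner ℂ w.2 x
  rw [inner_sub_right, this, sub_zero]
  exact h w hw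

theorem exists_norm_evalZero_le (hδ : S.EvalWellDefined) :
    ∃ C : ℝ, 0 ≤ C ∧ ∀ (x : LinRel.HPlus S.minRel) (y : S.L2),
      ((x : S.L2), y) ∈ LinRel.adj S.minRel →
        ‖S.evalZero x‖ ≤ C * LinRel.plusNorm S.minRel ((x : S.L2), y) := by
  obtain ⟨C, hC0, hC⟩ := S.exists_norm_apply_zero_le
  refine ⟨C * 2, by positivity, fun x y hxy => ?_⟩
  set K := (LinRel.dom S.minRel)ᗮ
  set d := Metric.infDist y (K : Set S.L2) with hd
  have hd0 : 0 ≤ d := Metric.infDist_nonneg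
  -- A near-minimizer `m` of the distance is subtracted from `y`, which leaves the value at `0`
  -- unchanged. The tolerance is `ε / (C + 1)` because `C` may be zero.
  have h1 : ∀ ε > 0, ‖S.evalZero x‖ ≤ C * (‖(x : S.L2)‖ + d) + ε := by
    intro ε hε
    obtain ⟨m, hm, hlt⟩ := (Metric.infDist_lt_iff (s := (K : Set S.L2)) ⟨0, K.zero_mem⟩).1
      (show Metric.infDist y (K : Set S.L2) < d + ε / (C + 1) from
        lt_add_of_pos_right _ (by positivity))
    obtain ⟨f, g, h, e⟩ := mem_adj_minRel_iff.1 (sub_mem_adj_of_mem_orthogonal hxy hm)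
    have e1 : (x : S.L2) = S.cls f := congrArg Prod.fst e
    have e2 : y - m = S.cls g := congrArg Prod.snd e
    rw [evalZero_eq hδ h e1]
    refine (hC f g h).trans ?_
    rw [← e1, ← e2, ← dist_eq_norm]
    have h3 : C * dist y m ≤ C * (d + ε / (C + 1)) := mul_le_mul_of_nonneg_left hlt.le hC0
    have h4 : C * (ε / (C + 1)) ≤ ε := by
      rw [← mul_div_assoc, div_le_iff₀ (by positivity)]
      nlinarith
    linarith
  have h2 := le_of_forall_pos_le_add h1
  have h3 : ‖(x : S.L2)‖ ≤ LinRel.plusNorm S.minRel ((x : S.L2), y) :=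
    Real.le_sqrt_of_sq_le (le_add_of_nonneg_right (by positivity))
  have h4 : d ≤ LinRel.plusNorm S.minRel ((x : S.L2), y) :=
    Real.le_sqrt_of_sq_le (le_add_of_nonneg_left (by positivity))
  refine h2.trans ?_
  rw [mul_assoc]
  exact mul_le_mul_of_nonneg_left (by linarith) hC0

theorem norm_star_dotProduct_le (v u : Fin p → ℂ) : ‖star v ⬝ᵥ u‖ ≤ (∑ i, ‖u i‖) * ‖v‖ := by
  rw [Finset.sum_mul]
  refine (norm_sum_le _ _).trans (Finset.sum_le_sum fun i _ => ?_)
  rw [norm_mul, Pi.star_apply, norm_star, mul_comm]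
  exact mul_le_mul_of_nonneg_left (norm_le_pi_norm v i) (norm_nonneg _)

/-- The map `L u = √2 δ ⊗ u`. -/
def gaugeMap (hδ : S.EvalWellDefined) : (Fin p → ℂ) →ₗ[ℂ] LinRel.HMinus S.minRel where
  toFun u := ⟨
    { toFun := fun x => (Real.sqrt 2 : ℂ) * (star (S.evalZero x) ⬝ᵥ u)
      map_add' := fun x y => by
        obtain ⟨f, g, h, e⟩ := exists_isSolution_of_mem_dom x.2
        obtain ⟨f', g', h', e'⟩ := exists_isSolution_of_mem_dom y.2
        rw [evalZero_eq hδ h e, evalZero_eq hδ h' e',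
          evalZero_eq (f := f + f') (g := g + g') hδ (h.add h')
            (by rw [Submodule.coe_add, e, e', cls_add]), ← mul_add, ← add_dotProduct, ← star_add]
        rfl
      map_smul' := fun c x => by
        obtain ⟨f, g, h, e⟩ := exists_isSolution_of_mem_dom x.2
        rw [evalZero_eq hδ h e, evalZero_eq (f := c • f) (g := c • g) hδ (h.smul c)
            (by rw [Submodule.coe_smul, e, cls_smul])]
        change _ * (star (c • f 0) ⬝ᵥ u) = _
        rw [star_smul, smul_dotProduct, smul_eq_mul, smul_eq_mul, starRingEnd_apply]
        ring }, by
    obtain ⟨C, hC0, hC⟩ := S.exists_norm_evalZero_le hδ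
    refine ⟨‖(Real.sqrt 2 : ℂ)‖ * ((∑ i, ‖u i‖) * C), fun x y hxy => ?_⟩
    change ‖(Real.sqrt 2 : ℂ) * (star (S.evalZero x) ⬝ᵥ u)‖ ≤ _
    rw [norm_mul, mul_assoc, mul_assoc]
    refine mul_le_mul_of_nonneg_left ((norm_star_dotProduct_le _ _).trans ?_) (norm_nonneg _)
    exact mul_le_mul_of_nonneg_left (hC x y hxy) (by positivity)⟩
  map_add' u v := Subtype.ext <| LinearMap.ext fun x => by
    change _ * (_ ⬝ᵥ (u + v)) = _ * (_ ⬝ᵥ u) + _ * (_ ⬝ᵥ v)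
    rw [dotProduct_add, mul_add]
  map_smul' c u := Subtype.ext <| LinearMap.ext fun x => by
    change _ * (_ ⬝ᵥ (c • u)) = c * (_ * (_ ⬝ᵥ u))
    rw [dotProduct_smul, smul_eq_mul, mul_left_comm]

theorem existsUnique_isGaugeMap (hδ : S.EvalWellDefined) :
    ∃! L : (Fin p → ℂ) →ₗ[ℂ] LinRel.HMinus S.minRel, S.IsGaugeMap L := by
  have h0 : S.IsGaugeMap (S.gaugeMap hδ) := fun u f g h hm => by
    rw [← evalZero_eq (x := ⟨S.cls f, hm⟩) hδ h rfl]
    rfl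
  refine ⟨S.gaugeMap hδ, h0, fun L hL => LinearMap.ext fun u => Subtype.ext <| LinearMap.ext ?_⟩
  rintro ⟨x, hx⟩
  obtain ⟨f, g, h, rfl⟩ := exists_isSolution_of_mem_dom hx
  exact (hL u f g h hx).trans (h0 u f g h hx).symm

end Gauge

end CanonicalSystem

/-! ### Resolvents, and uniqueness of the objects introduced by choice -/

namespace LinRel

variable {E : Type*} [NormedAddCommGroup E] [InnerProductSpace ℂ E]

theorem mem_shift_iff {T : LinRel E} {z : ℂ} {x y : E} :
    (x, y) ∈ shift T z ↔ (x, y + z • x) ∈ T := by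
  constructor
  · rintro ⟨⟨a, b⟩, h, e⟩
    obtain ⟨rfl, rfl⟩ := Prod.mk.inj e
    simpa using h
  · intro h
    exact ⟨_, h, by simp⟩

theorem eq_zero_of_mem_resolventSet {T : LinRel E} {z : ℂ} (hz : z ∈ resolventSet T) {x : E}
    (h : (x, z • x) ∈ T) : x = 0 := by
  have h1 : x ∈ ker (shift T z) := by
    change (x, (0 : E)) ∈ shift T z
    rwa [mem_shift_iff, zero_add]
  rwa [hz.1] at h1

theorem exists_mem_of_mem_resolventSet {T : LinRel E} {z : ℂ} (hz : z ∈ resolventSet T) (h : E) :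
    ∃ x, (x, h + z • x) ∈ T := by
  have h1 : h ∈ ran (shift T z) := hz.2 ▸ Submodule.mem_top
  obtain ⟨⟨x, y⟩, hx, rfl⟩ := h1
  exact ⟨x, mem_shift_iff.1 hx⟩

/-- The pairing separates points, so any candidate with the defining property is the chosen vector.
The same reasoning serves `gaugeAdj_eq` and `gammaAdj_eq`. -/
theorem dualAdj_eq {A : LinRel E} {B : E → HPlus A} {φ : HMinus A} {x : E}
    (h : ∀ y, inner ℂ y x = φ.1 (B y)) : dualAdj B φ = x := by
  have hs := Classical.epsilon_spec (p := fun x : E => ∀ h : E, inner ℂ h x = φ.1 (B h)) ⟨x, h⟩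
  exact ext_inner_left ℂ fun y => (hs y).trans (h y).symm

theorem gaugeAdj_eq {A : LinRel E} {p : ℕ} {L : (Fin p → ℂ) →ₗ[ℂ] HMinus A} {h : HPlus A}
    {w : Fin p → ℂ} (hw : ∀ ξ, (L ξ).1 h = star w ⬝ᵥ ξ) : gaugeAdj L h = w := by
  have hs := Classical.epsilon_spec
    (p := fun w : Fin p → ℂ => ∀ ξ : Fin p → ℂ, (L ξ).1 h = star w ⬝ᵥ ξ) ⟨w, hw⟩
  exact star_injective (dotProduct_eq _ _ fun ξ => (hs ξ).symm.trans (hw ξ))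

namespace BoundaryTriple

variable {A : LinRel E} {p : ℕ} (B : BoundaryTriple A p)

theorem gammaAdj_eq {z : ℂ} {φ : HMinus A} {w : Fin p → ℂ}
    (hw : ∀ ξ, φ.1 (B.gammaField z ξ) = star ξ ⬝ᵥ w) : B.gammaAdj z φ = w := by
  have hs := Classical.epsilon_spec
    (p := fun w : Fin p → ℂ => ∀ ξ : Fin p → ℂ, φ.1 (B.gammaField z ξ) = star ξ ⬝ᵥ w) ⟨w, hw⟩
  refine sub_eq_zero.1 (eq_zero_of_forall_star_dotProduct fun ξ => ?_)
  rw [dotProduct_sub, sub_eq_zero]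
  exact (hs ξ).symm.trans (hw ξ)

theorem mem_A₀_iff {x : E × E} : x ∈ B.A₀ ↔ ∃ h : x ∈ adj A, B.Γ₀ ⟨x, h⟩ = 0 := by
  constructor
  · rintro ⟨y, hy, rfl⟩
    exact ⟨y.2, hy⟩
  · rintro ⟨h, h0⟩
    exact ⟨⟨x, h⟩, h0, rfl⟩

theorem A₀_le_adj : B.A₀ ≤ adj A := fun _ hx => (B.mem_A₀_iff.1 hx).1

theorem resolvent_spec {z : ℂ} (hz : z ∈ B.A₀.resolventSet) (h : E) :
    ((B.resolvent z h : E), h + z • (B.resolvent z h : E)) ∈ B.A₀ := by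
  obtain ⟨x, hx⟩ := exists_mem_of_mem_resolventSet hz h
  exact Classical.epsilon_spec (p := fun f : HPlus A => ((f : E), h + z • (f : E)) ∈ B.A₀)
    ⟨⟨x, _, B.A₀_le_adj hx, rfl⟩, hx⟩

end BoundaryTriple

end LinRel

/-! ### Cayley transforms of `J`-unitary matrices -/

section CayleyMatrix

variable {p : ℕ} {J U W : Matrix (Fin p) (Fin p) ℂ}

theorem one_add_mul_nonsing_inv (hU : IsUnit (1 + U)) : (1 + U) * (1 + U)⁻¹ = 1 :=
  mul_nonsing_inv _ ((isUnit_iff_isUnit_det _).1 hU)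

theorem nonsing_inv_mul_one_add (hU : IsUnit (1 + U)) : (1 + U)⁻¹ * (1 + U) = 1 :=
  nonsing_inv_mul _ ((isUnit_iff_isUnit_det _).1 hU)

/-- Writing `1 - U = 2 - (1 + U)` makes the Weyl function affine in `(1 + U)⁻¹`, the form in which
it is compared with the resolvent block. -/
theorem neg_mul_one_sub_mul_inv (hU : IsUnit (1 + U)) :
    -(J * (1 - U) * (1 + U)⁻¹) = J - (2 : ℂ) • (J * (1 + U)⁻¹) := by
  have e : (1 : Matrix (Fin p) (Fin p) ℂ) - U = (2 : ℂ) • 1 - (1 + U) := by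
    rw [two_smul]; abel
  rw [mul_assoc, e, sub_mul, one_add_mul_nonsing_inv hU, smul_mul_assoc, one_mul, mul_sub, mul_one,
    mul_smul_comm, neg_sub]

/-- If `Wᴴ J U = J`, then `(1 + Wᴴ)` is conjugate to `1 + U⁻¹`. -/
theorem one_add_conjTranspose_mul (hW : Wᴴ * J * U = J) : (1 + Wᴴ) * (J * U) = J * (1 + U) := by
  rw [add_mul, one_mul, ← mul_assoc, hW, mul_add, mul_one, add_comm]

theorem isUnit_one_add_conjTranspose (hJ : IsUnit J) (hW : Wᴴ * J * U = J)
    (hU : IsUnit (1 + U)) : IsUnit (1 + Wᴴ) := by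
  have h := one_add_conjTranspose_mul hW
  rw [isUnit_iff_isUnit_det] at hJ hU ⊢
  have h2 := congrArg Matrix.det h
  rw [det_mul, det_mul J (1 + U)] at h2
  exact isUnit_of_mul_isUnit_left (h2 ▸ hJ.mul hU)

theorem isUnit_one_add_of_conjTranspose (h : IsUnit (1 + Wᴴ)) : IsUnit (1 + W) := by
  have := (isUnit_conjTranspose (A := 1 + Wᴴ)).2 h
  rwa [conjTranspose_add, conjTranspose_one, conjTranspose_conjTranspose] at this

theorem inv_one_add_conjTranspose_mul (hW : Wᴴ * J * U = J) (hU : IsUnit (1 + U))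
    (hW' : IsUnit (1 + Wᴴ)) : (1 + Wᴴ)⁻¹ * J = J - J * (1 + U)⁻¹ := by
  have h := one_add_conjTranspose_mul hW
  have hdet := (isUnit_iff_isUnit_det _).1 hW'
  have h1 : (1 + Wᴴ)⁻¹ * (J * (1 + U)) = J * U := by
    rw [← h, ← mul_assoc, nonsing_inv_mul _ hdet, one_mul]
  calc (1 + Wᴴ)⁻¹ * J = (1 + Wᴴ)⁻¹ * (J * (1 + U)) * (1 + U)⁻¹ := by
        rw [mul_assoc, mul_assoc, one_add_mul_nonsing_inv hU, mul_one]
    _ = J * ((1 + U) - 1) * (1 + U)⁻¹ := by rw [h1, add_sub_cancel_left]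
    _ = J - J * (1 + U)⁻¹ := by
        rw [mul_assoc, sub_mul, one_add_mul_nonsing_inv hU, one_mul, mul_sub, mul_one]

/-- The symmetry `M(z̄)^* = M(z)`, with `W` in the role of `U(z̄)`. -/
theorem conjTranspose_cayley (hJ : Jᴴ = -J) (hW : Wᴴ * J * U = J) (hU : IsUnit (1 + U))
    (hW' : IsUnit (1 + Wᴴ)) :
    (J - (2 : ℂ) • (J * (1 + W)⁻¹))ᴴ = J - (2 : ℂ) • (J * (1 + U)⁻¹) := by
  rw [conjTranspose_sub, conjTranspose_smul, conjTranspose_mul, conjTranspose_nonsing_inv,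
    conjTranspose_add, conjTranspose_one, hJ, mul_neg, inv_one_add_conjTranspose_mul hW hU hW']
  have : star (2 : ℂ) = 2 := Complex.conj_ofNat 2
  rw [this, neg_sub, smul_sub, two_smul ℂ J]
  abel

end CayleyMatrix

/-! ### The resolvent set and the four blocks -/

namespace CanonicalSystem

variable {p : ℕ} {S : CanonicalSystem p} {z : ℂ} {U W : ℝ → Matrix (Fin p) (Fin p) ℂ}
  {B : LinRel.BoundaryTriple S.minRel p} {L : (Fin p → ℂ) →ₗ[ℂ] LinRel.HMinus S.minRel}

theorem isUnit_J (S : CanonicalSystem p) : IsUnit S.J :=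
  IsUnit.of_mul_eq_one (-S.J) (by rw [mul_neg, J_mul_J, neg_neg])

theorem cls_congr {f g : S.PreL2} (h : ∀ t ∈ Set.Icc 0 S.l, f t = g t) : S.cls f = S.cls g := by
  rw [← sub_eq_zero, ← cls_sub, cls_eq_zero_iff]
  filter_upwards [ae_restrict_mem measurableSet_Ioo] with t ht
  change S.H t *ᵥ (f t - g t) = 0
  rw [h t (Set.Ioo_subset_Icc_self ht), sub_self, mulVec_zero]

theorem IsFundamentalMatrix.mem_adj (hU : S.IsFundamentalMatrix z U) (c : Fin p → ℂ) :
    (S.cls (S.fundamentalSolution hU c), z • S.cls (S.fundamentalSolution hU c)) ∈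
      LinRel.adj S.minRel := (hU.isSolution c).mem_adj

theorem IsFundamentalMatrix.exists_eq_of_mem_adj (hU : S.IsFundamentalMatrix z U) {x : S.L2}
    (hx : (x, z • x) ∈ LinRel.adj S.minRel) : ∃ c, x = S.cls (S.fundamentalSolution hU c) := by
  obtain ⟨f, g, h, e⟩ := mem_adj_minRel_iff.1 hx
  obtain ⟨rfl, e2⟩ := Prod.mk.inj e
  have h' : S.IsSolution f (z • f : S.PreL2) := h.congr_right e2.symm
  exact ⟨f 0, cls_congr fun t ht => hU.eq_mulVec h' ht⟩

theorem IsCanonicalTriple.Γ₀_fundamentalSolution (hB : S.IsCanonicalTriple B)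
    (hU : S.IsFundamentalMatrix z U) (c : Fin p → ℂ) :
    B.Γ₀ ⟨_, hU.mem_adj c⟩ = (1 / (Real.sqrt 2 : ℂ)) • (1 + U S.l) *ᵥ c := by
  refine (hB _ _ (hU.isSolution c) (hU.mem_adj c)).1.trans ?_
  rw [fundamentalSolution_zero, fundamentalSolution_apply, add_mulVec, one_mulVec]

theorem IsCanonicalTriple.Γ₁_fundamentalSolution (hB : S.IsCanonicalTriple B)
    (hU : S.IsFundamentalMatrix z U) (c : Fin p → ℂ) :
    B.Γ₁ ⟨_, hU.mem_adj c⟩ = -((1 / (Real.sqrt 2 : ℂ)) • (S.J * (1 - U S.l)) *ᵥ c) := by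
  refine (hB _ _ (hU.isSolution c) (hU.mem_adj c)).2.trans ?_
  rw [fundamentalSolution_zero, fundamentalSolution_apply, ← mulVec_mulVec, sub_mulVec, one_mulVec]

theorem one_div_sqrt_two_ne_zero : (1 / (Real.sqrt 2 : ℂ)) ≠ 0 :=
  one_div_ne_zero sqrt_two_ne_zero

theorem IsCanonicalTriple.mem_A₀_iff (hB : S.IsCanonicalTriple B) {x : S.L2 × S.L2} :
    x ∈ B.A₀ ↔ ∃ f g : S.PreL2, S.IsSolution f g ∧ f 0 + f S.l = 0 ∧ x = (S.cls f, S.cls g) := by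
  rw [B.mem_A₀_iff]
  constructor
  · rintro ⟨hx, h0⟩
    obtain ⟨f, g, h, rfl⟩ := mem_adj_minRel_iff.1 hx
    rw [(hB f g h hx).1, smul_eq_zero] at h0
    exact ⟨f, g, h, h0.resolve_left one_div_sqrt_two_ne_zero, rfl⟩
  · rintro ⟨f, g, h, h0, rfl⟩
    exact ⟨h.mem_adj, by rw [(hB f g h _).1, h0, smul_zero]⟩

theorem isUnit_of_forall_mulVec_eq_zero {A : Matrix (Fin p) (Fin p) ℂ}
    (h : ∀ c, A *ᵥ c = 0 → c = 0) : IsUnit A := by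
  rw [← mulVec_injective_iff_isUnit]
  intro c d hcd
  refine sub_eq_zero.1 (h _ ?_)
  rw [mulVec_sub]
  exact sub_eq_zero.2 hcd

theorem IsCanonicalTriple.fundamentalSolution_mem_A₀ (hB : S.IsCanonicalTriple B)
    (hU : S.IsFundamentalMatrix z U) {c : Fin p → ℂ} (hc : (1 + U S.l) *ᵥ c = 0) :
    (S.cls (S.fundamentalSolution hU c), z • S.cls (S.fundamentalSolution hU c)) ∈ B.A₀ :=
  hB.mem_A₀_iff.2 ⟨_, _, hU.isSolution c, by
    rw [fundamentalSolution_zero, fundamentalSolution_apply, ← hc, add_mulVec, one_mulVec], rfl⟩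

/-- The kernel of `A₀ - z` consists of the `U c` with `(1 + U(l)) c = 0`. When this matrix is
invertible, adding a suitable `U c` to a particular solution repairs the boundary condition, so the
range is everything. -/
theorem IsCanonicalTriple.mem_resolventSet_iff (hB : S.IsCanonicalTriple B)
    (hU : S.IsFundamentalMatrix z U) : z ∈ B.A₀.resolventSet ↔ IsUnit (1 + U S.l) := by
  constructor
  · intro hz
    exact isUnit_of_forall_mulVec_eq_zero fun c hc => hU.eq_zero_of_cls_eq_zero
      (LinRel.eq_zero_of_mem_resolventSet hz (hB.fundamentalSolution_mem_A₀ hU hc))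
  · intro hu
    constructor
    · rw [eq_bot_iff]
      intro x hx
      have h1 : (x, (0 : S.L2)) ∈ LinRel.shift B.A₀ z := hx
      rw [LinRel.mem_shift_iff, zero_add, B.mem_A₀_iff] at h1
      obtain ⟨h1, h2⟩ := h1
      obtain ⟨c, rfl⟩ := hU.exists_eq_of_mem_adj h1
      rw [hB.Γ₀_fundamentalSolution hU, smul_eq_zero] at h2
      have hc : c = 0 := Matrix.mulVec_injective_of_isUnit hu
        ((h2.resolve_left one_div_sqrt_two_ne_zero).trans (mulVec_zero _).symm)
      rw [hc]
      exact congrArg S.cls (map_zero hU.solutionMap)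
    · rw [eq_top_iff]
      intro x _
      obtain ⟨g, rfl⟩ := S.exists_cls_eq x
      obtain ⟨f, hf, hf0⟩ := S.exists_isSolution z g 0
      -- Since `f 0 = 0`, the condition that `f + U c` sum to zero over the endpoints is `(1 + U(l))
      -- c = -f(l)`.
      set c := -((1 + U S.l)⁻¹ *ᵥ f S.l)
      have hA : (S.cls (f + S.fundamentalSolution hU c),
          S.cls g + z • S.cls (f + S.fundamentalSolution hU c)) ∈ B.A₀ := by
        have e : S.cls g + z • S.cls (f + S.fundamentalSolution hU c) =
            S.cls (z • f + g + z • S.fundamentalSolution hU c) := by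
          rw [cls_add, cls_add, cls_add, cls_smul, cls_smul, smul_add]
          abel
        have hs : S.IsSolution (f + S.fundamentalSolution hU c : S.PreL2)
          (z • f + g + z • S.fundamentalSolution hU c : S.PreL2) := hf.add (hU.isSolution c)
        rw [e]
        refine hB.mem_A₀_iff.2 ⟨_, _, hs, ?_, rfl⟩
        change f 0 + S.fundamentalSolution hU c 0 + (f S.l + U S.l *ᵥ c) = 0
        rw [hf0, fundamentalSolution_zero]
        have : c + U S.l *ᵥ c = -f S.l := by
          calc c + U S.l *ᵥ c = (1 + U S.l) *ᵥ c := by rw [add_mulVec, one_mulVec]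
            _ = -f S.l := by
              rw [mulVec_neg, mulVec_mulVec, one_add_mul_nonsing_inv hu, one_mulVec]
        rw [zero_add, add_left_comm, this, add_neg_cancel]
      exact ⟨_, LinRel.mem_shift_iff.2 hA, rfl⟩

/-- A vector in the kernel gives a solution with `f(l) = -f(0)`, for which the boundary terms cancel
and Lagrange's identity reads `(z - z̄) ‖f‖² = 0`. -/
theorem IsFundamentalMatrix.isUnit_one_add_of_im_ne_zero (hU : S.IsFundamentalMatrix z U)
    (hz : z.im ≠ 0) : IsUnit (1 + U S.l) := by
  refine isUnit_of_forall_mulVec_eq_zero fun c hc => hU.eq_zero_of_cls_eq_zero ?_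
  have h := S.inner_cls_sub_inner_cls (hU.isSolution c) (hU.isSolution c)
  have hl : S.fundamentalSolution hU c S.l = -c := by
    rw [fundamentalSolution_apply, eq_neg_iff_add_eq_zero, ← hc, add_mulVec, one_mulVec, add_comm]
  rw [hl, fundamentalSolution_zero, star_neg, mulVec_neg, neg_dotProduct, dotProduct_neg, neg_neg,
    sub_self, cls_smul, inner_smul_right, inner_smul_left, ← sub_mul, mul_eq_zero,
    inner_self_eq_zero] at h
  refine h.resolve_left fun h0 => hz ?_
  have := congrArg Complex.im h0
  simp at this
  linarith

theorem IsCanonicalTriple.weyl_eq (hB : S.IsCanonicalTriple B)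
    (hU : S.IsFundamentalMatrix z U) (hu : IsUnit (1 + U S.l)) :
    B.weyl z = -(S.J * (1 - U S.l) * (1 + U S.l)⁻¹) := by
  have hM : ∀ (f : S.L2) (hf : (f, z • f) ∈ LinRel.adj S.minRel),
      -(S.J * (1 - U S.l) * (1 + U S.l)⁻¹) *ᵥ B.Γ₀ ⟨(f, z • f), hf⟩ = B.Γ₁ ⟨(f, z • f), hf⟩ := by
    intro f hf
    obtain ⟨c, rfl⟩ := hU.exists_eq_of_mem_adj hf
    rw [hB.Γ₀_fundamentalSolution hU, hB.Γ₁_fundamentalSolution hU, mulVec_smul, neg_mulVec,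
      mulVec_mulVec, mul_assoc _ _ (1 + U S.l), nonsing_inv_mul_one_add hu, mul_one, smul_neg]
  have hs := Classical.epsilon_spec (p := fun M : Matrix (Fin p) (Fin p) ℂ =>
    ∀ (f : S.L2) (hf : (f, z • f) ∈ LinRel.adj S.minRel),
      M *ᵥ B.Γ₀ ⟨(f, z • f), hf⟩ = B.Γ₁ ⟨(f, z • f), hf⟩) ⟨_, hM⟩
  -- The chosen matrix is tested only on boundary values of solutions, but these fill `ℂ^p` because
  -- `1 + U(l)` is invertible.
  have key : ∀ c, B.weyl z *ᵥ (1 + U S.l) *ᵥ c =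
      -(S.J * (1 - U S.l) * (1 + U S.l)⁻¹) *ᵥ (1 + U S.l) *ᵥ c := by
    intro c
    have h1 := (hs _ (hU.mem_adj c)).trans (hM _ (hU.mem_adj c)).symm
    rw [hB.Γ₀_fundamentalSolution hU, mulVec_smul, mulVec_smul] at h1
    exact smul_right_injective _ one_div_sqrt_two_ne_zero h1
  refine Matrix.ext_of_mulVec_single fun j => ?_
  have := key ((1 + U S.l)⁻¹ *ᵥ Pi.single j 1)
  rwa [mulVec_mulVec _ (1 + U S.l), one_add_mul_nonsing_inv hu, one_mulVec] at this

theorem IsCanonicalTriple.coe_gammaField (hB : S.IsCanonicalTriple B)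
    (hU : S.IsFundamentalMatrix z U) (hu : IsUnit (1 + U S.l)) (u : Fin p → ℂ) :
    (B.gammaField z u : S.L2) =
      S.cls (S.fundamentalSolution hU ((Real.sqrt 2 : ℂ) • (1 + U S.l)⁻¹ *ᵥ u)) := by
  have hex : ∃ f : LinRel.HPlus S.minRel, ∃ hf : ((f : S.L2), z • (f : S.L2)) ∈
      LinRel.adj S.minRel, B.Γ₀ ⟨((f : S.L2), z • (f : S.L2)), hf⟩ = u := by
    refine ⟨⟨_, (hU.isSolution ((Real.sqrt 2 : ℂ) • (1 + U S.l)⁻¹ *ᵥ u)).mem_dom⟩,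
      hU.mem_adj _, ?_⟩
    rw [hB.Γ₀_fundamentalSolution hU, mulVec_smul, mulVec_mulVec, one_add_mul_nonsing_inv hu,
      one_mulVec, smul_smul, one_div_mul_cancel sqrt_two_ne_zero, one_smul]
  obtain ⟨hf, h0⟩ := Classical.epsilon_spec hex
  change ((B.gammaField z u : S.L2), z • (B.gammaField z u : S.L2)) ∈ _ at hf
  obtain ⟨c, hc⟩ := hU.exists_eq_of_mem_adj hf
  have h1 : B.Γ₀ ⟨_, hU.mem_adj c⟩ = u := by
    rw [← h0]
    refine congrArg B.Γ₀ (Subtype.ext ?_)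
    change _ = ((B.gammaField z u : S.L2), z • (B.gammaField z u : S.L2))
    rw [hc]
  rw [hc, ← h1, hB.Γ₀_fundamentalSolution hU, mulVec_smul, mulVec_mulVec,
    nonsing_inv_mul_one_add hu, one_mulVec, smul_smul, mul_one_div_cancel sqrt_two_ne_zero,
    one_smul]

theorem IsGaugeMap.apply_eq (hL : S.IsGaugeMap L) {f g : S.PreL2} (h : S.IsSolution f g)
    {x : LinRel.HPlus S.minRel} (hx : (x : S.L2) = S.cls f) (u : Fin p → ℂ) :
    (L u).1 x = (Real.sqrt 2 : ℂ) * (star (f 0) ⬝ᵥ u) := by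
  obtain ⟨x, hm⟩ := x
  change x = S.cls f at hx
  subst hx
  exact hL u f g h hm

theorem IsGaugeMap.gaugeAdj_eq (hL : S.IsGaugeMap L) {f g : S.PreL2} (h : S.IsSolution f g)
    {x : LinRel.HPlus S.minRel} (hx : (x : S.L2) = S.cls f) :
    LinRel.gaugeAdj L x = (Real.sqrt 2 : ℂ) • f 0 :=
  LinRel.gaugeAdj_eq fun ξ => by
    rw [hL.apply_eq h hx, star_smul, smul_dotProduct, smul_eq_mul, star_sqrt_two]

theorem IsCanonicalTriple.gaugeAdj_gammaField (hB : S.IsCanonicalTriple B) (hL : S.IsGaugeMap L)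
    (hU : S.IsFundamentalMatrix z U) (hu : IsUnit (1 + U S.l)) (u : Fin p → ℂ) :
    LinRel.gaugeAdj L (B.gammaField z u) = ((2 : ℂ) • (1 + U S.l)⁻¹) *ᵥ u := by
  rw [hL.gaugeAdj_eq (hU.isSolution _) (hB.coe_gammaField hU hu u), fundamentalSolution_zero,
    smul_smul, sqrt_two_mul_self, smul_mulVec]

theorem IsCanonicalTriple.gammaAdj_gauge (hB : S.IsCanonicalTriple B) (hL : S.IsGaugeMap L)
    (hU : S.IsFundamentalMatrix z U) (hu : IsUnit (1 + U S.l)) (u : Fin p → ℂ) :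
    B.gammaAdj z (L u) = ((2 : ℂ) • (1 + (U S.l)ᴴ)⁻¹) *ᵥ u := by
  refine B.gammaAdj_eq fun ξ => ?_
  rw [hL.apply_eq (hU.isSolution _) (hB.coe_gammaField hU hu ξ), fundamentalSolution_zero,
    star_smul, smul_dotProduct, smul_eq_mul, star_sqrt_two, ← mul_assoc, sqrt_two_mul_self,
    star_mulVec_dotProduct, conjTranspose_nonsing_inv, conjTranspose_add, conjTranspose_one,
    smul_mulVec, dotProduct_smul, smul_eq_mul]

/-- The extended resolvent maps `L u` to a solution of the homogeneous system. -/
theorem IsCanonicalTriple.inner_fundamentalSolution (hB : S.IsCanonicalTriple B)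
    (hL : S.IsGaugeMap L) (hU : S.IsFundamentalMatrix z U) (hu : IsUnit (1 + U S.l))
    (hz : conj z ∈ B.A₀.resolventSet) (u : Fin p → ℂ) (h : S.L2) :
    inner ℂ h (S.cls (S.fundamentalSolution hU
      (-((Real.sqrt 2 : ℂ) • (1 + U S.l)⁻¹ *ᵥ S.J *ᵥ u)))) =
      (L u).1 (B.resolvent (conj z) h) := by
  set c := -((Real.sqrt 2 : ℂ) • (1 + U S.l)⁻¹ *ᵥ S.J *ᵥ u) with hc
  obtain ⟨f, g, hf, h0, e⟩ := hB.mem_A₀_iff.1 (B.resolvent_spec hz h)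
  obtain ⟨e1, e2⟩ := Prod.mk.inj e
  rw [hL.apply_eq hf e1]
  -- Here `f` represents the resolvent at `z̄` of `h`, so `g` represents `h + z̄ f` and the terms in
  -- `z` cancel. As `f(l) = -f(0)`, what remains is `f(0)^* J (1 + U(l)) c`; the choice of `c` and
  -- `J² = -1` turn it into `√2 f(0)^* u`.
  have key := S.inner_cls_sub_inner_cls (hU.isSolution c) hf
  have hcU : c + U S.l *ᵥ c = -((Real.sqrt 2 : ℂ) • S.J *ᵥ u) := by
    calc c + U S.l *ᵥ c = (1 + U S.l) *ᵥ c := by rw [add_mulVec, one_mulVec]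
      _ = _ := by
        rw [hc, mulVec_neg, mulVec_smul, mulVec_mulVec, one_add_mul_nonsing_inv hu, one_mulVec]
  have hl : f S.l = -f 0 := (neg_eq_of_add_eq_zero_right h0).symm
  rw [← e2, e1, cls_smul, inner_add_left, inner_smul_left, inner_smul_right, Complex.conj_conj,
    sub_add_eq_sub_sub_swap, sub_self, zero_sub, hl, fundamentalSolution_zero,
    fundamentalSolution_apply, star_neg, neg_dotProduct, ← neg_add', neg_inj, ← dotProduct_add,
    ← mulVec_add, add_comm, hcU, mulVec_neg, mulVec_smul, J_mulVec_J_mulVec, smul_neg, neg_neg,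
    dotProduct_smul, smul_eq_mul] at key
  exact key

/-- The extended resolvent and the adjoint of the regularizer send `L u` to explicit combinations of
homogeneous solutions for `z`, `i` and `-i`. Their difference lies in `H₊`, and `L^{⟨*⟩}` reads off
`√2` times its value at `0`. -/
theorem IsCanonicalTriple.gaugeAdj_regExtResolvent (hB : S.IsCanonicalTriple B)
    (hL : S.IsGaugeMap L) {V : ℂ → ℝ → Matrix (Fin p) (Fin p) ℂ}
    (hV : ∀ z, S.IsFundamentalMatrix z (V z)) (hz : z ∈ B.A₀.resolventSet)
    (hz' : conj z ∈ B.A₀.resolventSet) (hi : Complex.I ∈ B.A₀.resolventSet)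
    (hi' : -Complex.I ∈ B.A₀.resolventSet) (u : Fin p → ℂ) :
    LinRel.gaugeAdj L (B.regExtResolvent z (L u)) =
      -((2 : ℂ) • (((1 + V z S.l)⁻¹ - (1 / 2 : ℂ) • ((1 + V Complex.I S.l)⁻¹ +
        (1 + V (-Complex.I) S.l)⁻¹)) * S.J)) *ᵥ u := by
  let c : ℂ → Fin p → ℂ := fun w => -((Real.sqrt 2 : ℂ) • (1 + V w S.l)⁻¹ *ᵥ S.J *ᵥ u)
  let y : ℂ → S.PreL2 := fun w => S.fundamentalSolution (hV w) (c w)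
  have hy : ∀ w, w ∈ B.A₀.resolventSet → conj w ∈ B.A₀.resolventSet → ∀ h,
      inner ℂ h (S.cls (y w)) = (L u).1 (B.resolvent (conj w) h) := fun w hw hw' h =>
    hB.inner_fundamentalSolution hL (hV w) ((hB.mem_resolventSet_iff (hV w)).1 hw) hw' u h
  have hext : B.extResolvent z (L u) = S.cls (y z) := LinRel.dualAdj_eq (hy z hz hz')
  have hreg : LinRel.dualAdj B.regularizer (L u) =
      S.cls ((1 / 2 : ℂ) • (y Complex.I + y (-Complex.I))) := by
    refine LinRel.dualAdj_eq fun h => ?_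
    -- The solution with parameter `i` represents the adjoint of the resolvent at `-i`, and
    -- conversely; the average is unaffected by this exchange.
    have h1 := hy Complex.I hi (by rwa [Complex.conj_I]) h
    have h2 := hy (-Complex.I) hi' (by rwa [map_neg, Complex.conj_I, neg_neg]) h
    rw [Complex.conj_I] at h1
    rw [map_neg, Complex.conj_I, neg_neg] at h2
    rw [cls_smul, cls_add, inner_smul_right, inner_add_right, h1, h2, LinRel.BoundaryTriple.regularizer,
      LinearMap.map_smulₛₗ, map_add, smul_eq_mul, add_comm]
    simp only [map_div₀, map_one, Complex.conj_ofNat]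
  have hsol := ((hV z).isSolution (c z)).sub
    ((((hV Complex.I).isSolution (c Complex.I)).add
      ((hV (-Complex.I)).isSolution (c (-Complex.I)))).smul (1 / 2 : ℂ))
  have hsol' : S.IsSolution (y z - (1 / 2 : ℂ) • (y Complex.I + y (-Complex.I)) : S.PreL2)
    (z • y z - (1 / 2 : ℂ) • (Complex.I • y Complex.I + (-Complex.I) • y (-Complex.I)) : S.PreL2) :=
    hsol
  have hcoe : (B.regExtResolvent z (L u) : S.L2) =
      S.cls (y z - (1 / 2 : ℂ) • (y Complex.I + y (-Complex.I))) := by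
    have hex : ∃ f : LinRel.HPlus S.minRel,
        (f : S.L2) = B.extResolvent z (L u) - LinRel.dualAdj B.regularizer (L u) :=
      ⟨⟨_, hsol'.mem_dom⟩, (S.cls_sub _ _).trans (by rw [hext, hreg])⟩
    refine (Classical.epsilon_spec hex).trans ?_
    rw [hext, hreg, cls_sub]
  rw [hL.gaugeAdj_eq hsol' hcoe]
  have h0 : (y z - (1 / 2 : ℂ) • (y Complex.I + y (-Complex.I)) : S.PreL2) 0 =
      c z - (1 / 2 : ℂ) • (c Complex.I + c (-Complex.I)) := by
    change y z 0 - (1 / 2 : ℂ) • (y Complex.I 0 + y (-Complex.I) 0) = _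
    simp only [y, fundamentalSolution_zero]
  rw [h0]
  simp only [c, neg_mulVec, smul_mulVec, ← mulVec_mulVec, sub_mulVec, add_mulVec]
  generalize (1 + V z S.l)⁻¹ *ᵥ S.J *ᵥ u = v
  generalize (1 + V Complex.I S.l)⁻¹ *ᵥ S.J *ᵥ u = v₁
  generalize (1 + V (-Complex.I) S.l)⁻¹ *ᵥ S.J *ᵥ u = v₂
  calc _ = -(((Real.sqrt 2 : ℂ) * (Real.sqrt 2 : ℂ)) • (v - (1 / 2 : ℂ) • (v₁ + v₂))) := by module
    _ = _ := by rw [sqrt_two_mul_self]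

theorem of_apply_eq_of_forall_mulVec {A : Matrix (Fin p) (Fin p) ℂ}
    {F : (Fin p → ℂ) → Fin p → ℂ} (h : ∀ u, F u = A *ᵥ u) :
    (Matrix.of fun i j => F (Pi.single j 1) i) = A := by
  ext i j
  rw [of_apply, h, mulVec_single_one, col_apply]

end CanonicalSystem

end

theorem proposition5p2 {p : ℕ} (S : CanonicalSystem p) (hδ : S.EvalWellDefined) :
    S.maxRel = LinRel.adj S.minRel ∧
    (∃! B : LinRel.BoundaryTriple S.minRel p, S.IsCanonicalTriple B) ∧
    (∃! L : (Fin p → ℂ) →ₗ[ℂ] LinRel.HMinus S.minRel, S.IsGaugeMap L) ∧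
    (∀ z : ℂ, ∃ U : ℝ → Matrix (Fin p) (Fin p) ℂ, S.IsFundamentalMatrix z U) ∧
    ∀ (B : LinRel.BoundaryTriple S.minRel p)
      (L : (Fin p → ℂ) →ₗ[ℂ] LinRel.HMinus S.minRel)
      (V : ℂ → ℝ → Matrix (Fin p) (Fin p) ℂ),
      S.IsCanonicalTriple B → S.IsGaugeMap L → (∀ z, S.IsFundamentalMatrix z (V z)) →
      let U : ℂ → Matrix (Fin p) (Fin p) ℂ := fun z => V z S.l
      let M : ℂ → Matrix (Fin p) (Fin p) ℂ := fun z => -(S.J * (1 - U z) * (1 + U z)⁻¹)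
      Complex.I ∈ B.A₀.resolventSet ∧ -Complex.I ∈ B.A₀.resolventSet ∧
      ∀ z ∈ B.A₀.resolventSet,
        IsUnit (1 + U z) ∧ IsUnit (1 + (U (conj z))ᴴ) ∧
        B.preresolventMatrix L z =
          Matrix.fromBlocks
            (M z)
            ((2 : ℂ) • (1 + (U (conj z))ᴴ)⁻¹)
            ((2 : ℂ) • (1 + U z)⁻¹)
            (S.J * (-M z + (1 / 2 : ℂ) • (M Complex.I + (M Complex.I)ᴴ)) * S.J) := by
  refine ⟨S.maxRel_eq_adj_minRel, S.existsUnique_isCanonicalTriple,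
    CanonicalSystem.existsUnique_isGaugeMap hδ, S.exists_isFundamentalMatrix, ?_⟩
  intro B L V hB hL hV U M
  have hρ : ∀ w, w ∈ B.A₀.resolventSet ↔ IsUnit (1 + U w) := fun w =>
    hB.mem_resolventSet_iff (hV w)
  have hi : Complex.I ∈ B.A₀.resolventSet :=
    (hρ _).2 ((hV _).isUnit_one_add_of_im_ne_zero (by simp))
  have hi' : -Complex.I ∈ B.A₀.resolventSet :=
    (hρ _).2 ((hV _).isUnit_one_add_of_im_ne_zero (by simp))
  refine ⟨hi, hi', fun z hz => ?_⟩
  have hsymp : ∀ w, (U (conj w))ᴴ * S.J * U w = S.J := fun w =>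
    (hV w).conjTranspose_mul_J_mul (hV (conj w)) S.l_mem_Icc
  have hu := (hρ z).1 hz
  have hu' : IsUnit (1 + (U (conj z))ᴴ) := isUnit_one_add_conjTranspose S.isUnit_J (hsymp z) hu
  have huc : IsUnit (1 + U (conj z)) := isUnit_one_add_of_conjTranspose hu'
  refine ⟨hu, hu', ?_⟩
  have h22 : S.J * (-M z + (1 / 2 : ℂ) • (M Complex.I + (M Complex.I)ᴴ)) * S.J =
      -((2 : ℂ) • (((1 + U z)⁻¹ - (1 / 2 : ℂ) • ((1 + U Complex.I)⁻¹ +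
        (1 + U (-Complex.I))⁻¹)) * S.J)) := by
    have hM : ∀ w, IsUnit (1 + U w) → M w = S.J - (2 : ℂ) • (S.J * (1 + U w)⁻¹) := fun w hw =>
      neg_mul_one_sub_mul_inv hw
    -- At `-i` the identity becomes `U(i)^* J U(-i) = J`, which replaces `M(i)^*` by `M(-i)`. The
    -- constant terms `J` then cancel between `-M(z)` and the average.
    have hs := hsymp (-Complex.I)
    rw [map_neg, Complex.conj_I, neg_neg] at hs
    have hn := (hρ _).1 hi'
    rw [hM z hu, hM _ ((hρ _).1 hi), conjTranspose_cayley S.J_conjTranspose hs hn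
      (isUnit_one_add_conjTranspose S.isUnit_J hs hn)]
    have e : -(S.J - (2 : ℂ) • (S.J * (1 + U z)⁻¹)) + (1 / 2 : ℂ) •
        (S.J - (2 : ℂ) • (S.J * (1 + U Complex.I)⁻¹) +
          (S.J - (2 : ℂ) • (S.J * (1 + U (-Complex.I))⁻¹))) =
        S.J * ((2 : ℂ) • ((1 + U z)⁻¹ - (1 / 2 : ℂ) • ((1 + U Complex.I)⁻¹ +
          (1 + U (-Complex.I))⁻¹))) := by
      simp only [mul_smul_comm, mul_sub, mul_add]
      module
    rw [e, ← mul_assoc, S.J_mul_J, neg_mul, neg_mul, one_mul, smul_mul_assoc]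
  rw [h22, LinRel.BoundaryTriple.preresolventMatrix, hB.weyl_eq (hV z) hu,
    CanonicalSystem.of_apply_eq_of_forall_mulVec fun u =>
      hB.gammaAdj_gauge hL (hV (conj z)) huc u,
    CanonicalSystem.of_apply_eq_of_forall_mulVec fun u => hB.gaugeAdj_gammaField hL (hV z) hu u,
    CanonicalSystem.of_apply_eq_of_forall_mulVec fun u =>
      hB.gaugeAdj_regExtResolvent hL hV hz ((hρ _).2 huc) hi hi' u]
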